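/- For integers $a,b\ge 1$, the $a$ by $b$ undented Aztec rectangle is the union of the unit squares with integral vertices contained in the region $b-2a-1\le x+y\le b+1$, $-(b+1)\le y-x\le b+1$; a domino is the union of two unit squares sharing an edge. Let $V_n=1!\,2!\cdots n!$ (with $V_{-1}=V_0=1$). Let $k\ge 1$. The $(2k-1)$ by $2k$ undented Aztec rectangle has a central square, namely the unit square whose center is the center $(\tfrac12,\tfrac12)$ of that region. Remove any one of the four unit squares that share an edge with the central square. Then the number of domino tilings of the remaining region is as follows. If $k=2q$ (with $q\ge 1$), it is \[ \frac{2^{(2q)^2+2q-1}}{V_{2q-2}V_{2q-1}}\; \prod_{d=1}^{q-1}(2d)^{4(q-d)-1}\; \prod_{d=1}^{q-1}(2d+1)^{2d}\; \prod_{d=0}^{q-1}(2q+1+2d)^{2q-1-2d}, \] that is, $\frac{2^{(2q)^2+2q-1}}{V_{2q-2}V_{2q-1}}\,2^{4q-5}4^{4q-9}\cdots(2q-2)^3\cdot 3^2 5^4\cdots(2q-1)^{2q-2}(2q+1)^{2q-1}(2q+3)^{2q-3}\cdots(4q-3)^3(4q-1)$. If $k=2q+1$ (with $q\ge 0$), it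 is \[ \frac{2^{(2q+1)^2+(2q+1)-1}}{V_{2q-1}V_{2q}}\; \prod_{d=1}^{q}(2d)^{4(q-d)+1}\; \prod_{d=1}^{q}(2d+1)^{2d}\; \prod_{d=1}^{q}(2q+1+2d)^{2q+1-2d}, \] that is, $\frac{2^{(2q+1)^2+(2q+1)-1}}{V_{2q-1}V_{2q}}\,2^{4q-3}4^{4q-7}\cdots(2q-2)^5(2q)\cdot 3^2 5^4\cdots(2q-1)^{2q-2}(2q+1)^{2q}(2q+3)^{2q-1}\cdots(4q-1)^3(4q+1)$. Empty products are $1$. -/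

import Mathlib

/-- The closed unit square in the plane with lower left corner `c`. A pair of integers `c` stands
for this square throughout. -/
def unitSquare (c : ℤ × ℤ) : Set (ℝ × ℝ) :=
  {p | (c.1 : ℝ) ≤ p.1 ∧ p.1 ≤ c.1 + 1 ∧ (c.2 : ℝ) ≤ p.2 ∧ p.2 ≤ c.2 + 1}

/-- The tilted rectangle bounded by `x + y ≤ b + 1`, `x + y ≥ b - 2a - 1`, `y - x ≤ b + 1`,
`y - x ≥ -(b + 1)`. -/
def tiltedRectangle (a b : ℕ) : Set (ℝ × ℝ) :=
  {p | p.1 + p.2 ≤ (b : ℝ) + 1 ∧ (b : ℝ) - 2 * a - 1 ≤ p.1 + p.2 ∧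
    p.2 - p.1 ≤ (b : ℝ) + 1 ∧ -((b : ℝ) + 1) ≤ p.2 - p.1}

/-- The `a` by `b` undented Aztec rectangle, as a set of unit squares. -/
def undentedAztecRectangle (a b : ℕ) : Set (ℤ × ℤ) :=
  {c | unitSquare c ⊆ tiltedRectangle a b}

/-- The square `c` is central: its center `(c.1 + 1/2, c.2 + 1/2)` is the center of the tilted
rectangle, which is the point with `x + y = b - a` and `y - x = 0`. -/
def IsCentralSquare (a b : ℕ) (c : ℤ × ℤ) : Prop :=
  ((c.1 : ℝ) + 1 / 2) + ((c.2 : ℝ) + 1 / 2) = (b : ℝ) - a ∧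
    ((c.2 : ℝ) + 1 / 2) - ((c.1 : ℝ) + 1 / 2) = 0

/-- Two unit squares adjoin if they share an edge. -/
def Adjoins (c d : ℤ × ℤ) : Prop :=
  (c.1 = d.1 ∧ |c.2 - d.2| = 1) ∨ (c.2 = d.2 ∧ |c.1 - d.1| = 1)

/-- A domino, a 1 by 2 rectangle in either direction, as the set of its two squares. -/
def IsDomino (D : Set (ℤ × ℤ)) : Prop :=
  ∃ c d : ℤ × ℤ, Adjoins c d ∧ D = {c, d}

/-- `T` is a tiling of the set `R` of unit squares by dominoes: the members of `T` are dominoes,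
no two of them share a square, and together they cover exactly `R`. -/
def IsDominoTiling (R : Set (ℤ × ℤ)) (T : Set (Set (ℤ × ℤ))) : Prop :=
  (∀ D ∈ T, IsDomino D) ∧ T.PairwiseDisjoint id ∧ ⋃₀ T = R

/-- The number of domino tilings of `R`. -/
noncomputable def numDominoTilings (R : Set (ℤ × ℤ)) : ℕ :=
  {T : Set (Set (ℤ × ℤ)) | IsDominoTiling R T}.ncard

/-- The superfactorial `V n = 1! 2! ⋯ n!`. -/
def V (n : ℕ) : ℕ := ∏ i ∈ Finset.Icc 1 n, i.factorial

/-! Sort the unit squares into rows by u = x + y, where (x, y) is the lower left corner. Every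
domino joins consecutive rows, and the square at position y of row u touches just the positions y
and y + 1 of row u + 1. By symmetry the removed neighbor of the center may be taken to lie at
position 0 of row 1. Each of the 2k - 1 other squares of that row is paired either upward or
downward. If X is the set of their positions and S the part paired upward, the count is a sum over S
of (tilings above row 1 with S attached) times (tilings below row 1 with X \ S attached).

Each factor counts tilings of a dented Aztec rectangle, and equals a constant times the product Δ of
differences of the attached positions (`count_dented`). This is proved by peeling rows. If the count
after peeling is a weighted Vandermonde determinant in the positions used up, then summing over the
choices "y or y + 1" is row multilinearity. The result is again a Vandermonde determinant, up to row
factors and the leading coefficients of certain polynomials (`count_insert_row`).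

What remains is the sum of Δ(S) Δ(X \ S) over S with k - 1 elements. Since Δ(X \ S) is Δ(X) Δ(S)
times a product of weights over S, Cauchy–Binet turns the sum into a Hankel determinant of moments
on X. The vanishing of divided differences of low powers replaces these by moments, with doubled
weights, on every second point of X. There Cauchy–Binet has a single term, so the sum is 2^(k-1)
Δ(Y) Δ(X \ Y) for the alternating subset Y (`sum_diffProd_mul_diffProd_sdiff`). Both alternating
parts are explicit, and recursion on their size gives the stated products. -/

/-! ### Matching counts characterized by expansion at a vertex -/

open Classical in
/-- `M` counts the perfect matchings of finite vertex sets for the adjacency relation `adj`. -/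
structure IsMatchingCount {α : Type*} [DecidableEq α] (adj : α → α → Prop)
    (M : Finset α → ℚ) : Prop where
  empty : M ∅ = 1
  expand : ∀ (R : Finset α) (a : α), a ∈ R →
    M R = ∑ d ∈ R with adj a d, M ((R.erase a).erase d)

namespace IsMatchingCount

variable {α β : Type*} [DecidableEq α] [DecidableEq β] {adj : α → α → Prop} {M N : Finset α → ℚ}

/-- The expansion strictly shrinks the vertex set, so it determines the count. Invariance under
symmetries, `map_eq`, follows from this without any bijection of matchings. -/
theorem unique (hM : IsMatchingCount adj M) (hN : IsMatchingCount adj N) (R : Finset α) :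
    M R = N R := by
  classical
  induction R using Finset.strongInduction with
  | H R ih =>
    rcases R.eq_empty_or_nonempty with rfl | ⟨a, ha⟩
    · rw [hM.empty, hN.empty]
    · rw [hM.expand R a ha, hN.expand R a ha]
      refine Finset.sum_congr rfl fun d _ => ih _ ?_
      exact (Finset.erase_subset _ _).trans_ssubset (Finset.erase_ssubset ha)

theorem comp (hM : IsMatchingCount adj M) (σ : β ≃ α) :
    IsMatchingCount (fun a b => adj (σ a) (σ b)) (fun R => M (R.map σ.toEmbedding)) where
  empty := by simpa using hM.empty
  expand R a ha := by
    classical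
    rw [hM.expand (R.map σ.toEmbedding) (σ a) (by simpa using ha), Finset.filter_map,
      Finset.sum_map]
    refine Finset.sum_congr rfl fun d _ => ?_
    rw [Finset.map_erase, Finset.map_erase]
    rfl

theorem map_eq (hM : IsMatchingCount adj M) (σ : α ≃ α)
    (hσ : ∀ a b, adj (σ a) (σ b) ↔ adj a b) (R : Finset α) :
    M (R.map σ.toEmbedding) = M R := by
  have h := hM.comp σ
  simp only [hσ] at h
  exact h.unique hM R

open Classical in
theorem expand_insert (hM : IsMatchingCount adj M) (irr : ∀ a, ¬ adj a a) {b : α} {P S : Finset α}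
    (hP : b ∉ P) (hS : b ∉ S) (hPS : Disjoint P S) (hadj : ∀ s ∈ S, ¬ adj b s) :
    M (insert b (P ∪ S)) = ∑ d ∈ P with adj b d, M (P.erase d ∪ S) := by
  rw [hM.expand _ b (Finset.mem_insert_self _ _)]
  have h1 : (insert b (P ∪ S)).filter (fun d => adj b d) = P.filter (fun d => adj b d) := by
    ext d
    simp only [Finset.mem_filter, Finset.mem_insert, Finset.mem_union]
    constructor
    · rintro ⟨rfl | h | h, h2⟩
      · exact absurd h2 (irr _)
      · exact ⟨h, h2⟩
      · exact absurd h2 (hadj _ h)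
    · rintro ⟨h, h2⟩
      exact ⟨Or.inr (Or.inl h), h2⟩
  rw [h1]
  refine Finset.sum_congr rfl fun d hd => ?_
  have hdP := (Finset.mem_filter.1 hd).1
  rw [Finset.erase_insert (by simp [hP, hS]), Finset.erase_union_distrib,
    Finset.erase_eq_of_notMem (Finset.disjoint_left.1 hPS hdP)]

/-- Matchings of a disconnected vertex set. -/
theorem union (hM : IsMatchingCount adj M) (irr : ∀ a, ¬ adj a a) (Q : Finset α) :
    ∀ P : Finset α, Disjoint P Q → (∀ p ∈ P, ∀ q ∈ Q, ¬ adj p q) → M (P ∪ Q) = M P * M Q := by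
  classical
  intro P
  induction P using Finset.strongInduction with
  | H P ih =>
    intro hd hadj
    rcases P.eq_empty_or_nonempty with rfl | ⟨a, ha⟩
    · rw [hM.empty, Finset.empty_union, one_mul]
    · have h1 : P ∪ Q = insert a (P.erase a ∪ Q) := by
        rw [← Finset.insert_union, Finset.insert_erase ha]
      have h2 : P = insert a (P.erase a ∪ ∅) := by
        rw [← Finset.insert_union, Finset.insert_erase ha, Finset.union_empty]
      have hd' : Disjoint (P.erase a) Q := hd.mono_left (Finset.erase_subset _ _)
      rw [h1, hM.expand_insert irr (Finset.notMem_erase _ _) (Finset.disjoint_left.1 hd ha) hd'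
        (hadj a ha)]
      conv_rhs => rw [h2]
      rw [hM.expand_insert irr (Finset.notMem_erase _ _) (Finset.notMem_empty _)
        (Finset.disjoint_empty_right _) (by simp), Finset.sum_mul]
      refine Finset.sum_congr rfl fun d _ => ?_
      rw [Finset.union_empty]
      have hsub : (P.erase a).erase d ⊆ P :=
        (Finset.erase_subset _ _).trans (Finset.erase_subset _ _)
      refine ih _ ((Finset.erase_subset _ _).trans_ssubset (Finset.erase_ssubset ha))
        (hd.mono_left hsub) fun p hp => hadj p (hsub hp)

/-- Cutting along an independent set `B` that separates `P` from `Q`. -/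
theorem cut (hM : IsMatchingCount adj M) (irr : ∀ a, ¬ adj a a) (B : Finset α) :
    ∀ P Q : Finset α, Disjoint P Q → Disjoint P B → Disjoint Q B →
      (∀ p ∈ P, ∀ q ∈ Q, ¬ adj p q) → (∀ b ∈ B, ∀ c ∈ B, ¬ adj b c) →
      M (B ∪ (P ∪ Q)) = ∑ S ∈ B.powerset, M (P ∪ S) * M (Q ∪ (B \ S)) := by
  classical
  induction B using Finset.induction_on with
  | empty =>
    intro P Q hPQ _ _ hadj _
    simp [hM.union irr Q P hPQ hadj]
  | insert b B hb ih =>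
    intro P Q hPQ hPB hQB hadj hB
    rw [Finset.disjoint_insert_right] at hPB hQB
    have hbB : ∀ s ∈ B, ¬ adj b s := fun s hs =>
      hB b (Finset.mem_insert_self _ _) s (Finset.mem_insert_of_mem hs)
    have hBB : ∀ b ∈ B, ∀ c ∈ B, ¬ adj b c := fun s hs c hc =>
      hB s (Finset.mem_insert_of_mem hs) c (Finset.mem_insert_of_mem hc)
    -- The partner of `b` lies in `P` or in `Q`, never in `B`, which is independent.
    have hexp : M (insert b B ∪ (P ∪ Q)) =
        (∑ d ∈ P with adj b d, M (B ∪ (P.erase d ∪ Q))) +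
          ∑ d ∈ Q with adj b d, M (B ∪ (P ∪ Q.erase d)) := by
      rw [Finset.insert_union, Finset.union_comm B, hM.expand_insert irr (by simp [hPB.1, hQB.1]) hb
        (Finset.disjoint_union_left.2 ⟨hPB.2, hQB.2⟩) hbB, Finset.filter_union,
        Finset.sum_union (Finset.disjoint_filter_filter hPQ)]
      congr 1
      · refine Finset.sum_congr rfl fun d hd => ?_
        have hdP := (Finset.mem_filter.1 hd).1
        rw [Finset.erase_union_distrib, Finset.erase_eq_of_notMem (Finset.disjoint_left.1 hPQ hdP),
          Finset.union_comm B]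
      · refine Finset.sum_congr rfl fun d hd => ?_
        have hdQ := (Finset.mem_filter.1 hd).1
        rw [Finset.erase_union_distrib, Finset.erase_eq_of_notMem (Finset.disjoint_right.1 hPQ hdQ),
          Finset.union_comm B]
    have e1 : ∀ d ∈ P.filter (fun d => adj b d), M (B ∪ (P.erase d ∪ Q)) =
        ∑ S ∈ B.powerset, M (P.erase d ∪ S) * M (Q ∪ (B \ S)) := fun d _ =>
      ih _ _ (hPQ.mono_left (Finset.erase_subset _ _)) (hPB.2.mono_left (Finset.erase_subset _ _))
        hQB.2 (fun p hp => hadj p (Finset.mem_of_mem_erase hp)) hBB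
    have e2 : ∀ d ∈ Q.filter (fun d => adj b d), M (B ∪ (P ∪ Q.erase d)) =
        ∑ S ∈ B.powerset, M (P ∪ S) * M (Q.erase d ∪ (B \ S)) := fun d _ =>
      ih _ _ (hPQ.mono_right (Finset.erase_subset _ _)) hPB.2
        (hQB.2.mono_left (Finset.erase_subset _ _))
        (fun p hp q hq => hadj p hp q (Finset.mem_of_mem_erase hq)) hBB
    rw [hexp, Finset.sum_congr rfl e1, Finset.sum_congr rfl e2, Finset.sum_powerset_insert hb,
      add_comm, Finset.sum_comm, Finset.sum_comm (s := P.filter _)]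
    -- After `add_comm` the first summand is the case of `b` matched into `Q`, to be compared with
    -- the sets `S` that omit `b`; the second is the case of `b` matched into `P`.
    congr 1
    · refine Finset.sum_congr rfl fun S hS => ?_
      have hS := Finset.mem_powerset.1 hS
      have hbS : b ∉ S := fun h => hb (hS h)
      rw [Finset.insert_sdiff_of_notMem _ hbS, Finset.union_insert,
        hM.expand_insert irr hQB.1 (by simp [hb]) (hQB.2.mono_right Finset.sdiff_subset)
        (fun s hs => hbB s (Finset.sdiff_subset hs)), Finset.mul_sum]
    · refine Finset.sum_congr rfl fun S hS => ?_
      have hS := Finset.mem_powerset.1 hS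
      have hbS : b ∉ S := fun h => hb (hS h)
      have : insert b B \ insert b S = B \ S := by
        ext x; simp only [Finset.mem_sdiff, Finset.mem_insert, not_or]
        constructor
        · rintro ⟨rfl | h, h2, h3⟩
          · exact absurd rfl h2
          · exact ⟨h, h3⟩
        · rintro ⟨h, h3⟩
          exact ⟨Or.inr h, fun h4 => hb (h4 ▸ h), h3⟩
      rw [this, Finset.union_insert, hM.expand_insert irr hPB.1 hbS (hPB.2.mono_right hS)
        (fun s hs => hbB s (hS hs)), Finset.sum_mul]

end IsMatchingCount

/-! ### Domino tilings form a matching count -/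

theorem Adjoins.symm {c d : ℤ × ℤ} (h : Adjoins c d) : Adjoins d c := by
  unfold Adjoins at *
  rw [abs_sub_comm d.2, abs_sub_comm d.1, eq_comm (a := d.1), eq_comm (a := d.2)]
  exact h

theorem not_adjoins_self (c : ℤ × ℤ) : ¬ Adjoins c c := by
  simp [Adjoins]

theorem IsDominoTiling.subset {R : Set (ℤ × ℤ)} {T : Set (Set (ℤ × ℤ))} (h : IsDominoTiling R T)
    {D : Set (ℤ × ℤ)} (hD : D ∈ T) : D ⊆ R :=
  h.2.2 ▸ Set.subset_sUnion_of_mem hD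

theorem IsDominoTiling.exists_partner {R : Set (ℤ × ℤ)} {T : Set (Set (ℤ × ℤ))}
    (h : IsDominoTiling R T) {a : ℤ × ℤ} (ha : a ∈ R) : ∃ d ∈ R, Adjoins a d ∧ {a, d} ∈ T := by
  rw [← h.2.2] at ha
  obtain ⟨D, hD, haD⟩ := ha
  obtain ⟨c, d, hcd, rfl⟩ := h.1 D hD
  have hsub := h.subset hD
  rcases haD with rfl | haD
  · exact ⟨d, hsub (by simp), hcd, hD⟩
  · rw [Set.mem_singleton_iff] at haD
    subst haD
    exact ⟨c, hsub (by simp), hcd.symm, by rwa [Set.pair_comm]⟩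

theorem IsDominoTiling.eq_of_pair_mem {R : Set (ℤ × ℤ)} {T : Set (Set (ℤ × ℤ))}
    (h : IsDominoTiling R T) {a d d' : ℤ × ℤ} (h1 : {a, d} ∈ T) (h2 : {a, d'} ∈ T)
    (hd : a ≠ d) : d = d' := by
  have h3 : ({a, d} : Set (ℤ × ℤ)) = {a, d'} :=
    h.2.1.elim_set h1 h2 a (by simp) (by simp)
  have : d ∈ ({a, d'} : Set (ℤ × ℤ)) := h3 ▸ (by simp)
  rcases this with h4 | h4
  · exact absurd h4.symm hd
  · exact h4

theorem IsDominoTiling.insert_pair {R : Set (ℤ × ℤ)} {T : Set (Set (ℤ × ℤ))} {a d : ℤ × ℤ}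
    (h : IsDominoTiling (R \ {a, d}) T) (ha : a ∈ R) (hd : d ∈ R) (had : Adjoins a d) :
    IsDominoTiling R (insert {a, d} T) := by
  refine ⟨?_, ?_, ?_⟩
  · rintro D (rfl | hD)
    · exact ⟨a, d, had, rfl⟩
    · exact h.1 D hD
  · refine (Set.pairwiseDisjoint_insert).2 ⟨h.2.1, fun D hD _ => ?_⟩
    exact Set.disjoint_left.2 fun x hx hxD => (h.subset hD hxD).2 hx
  · rw [Set.sUnion_insert, h.2.2, Set.union_sdiff_cancel]
    rintro x (rfl | rfl)
    · exact ha
    · exact hd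

theorem IsDominoTiling.diff_pair {R : Set (ℤ × ℤ)} {T : Set (Set (ℤ × ℤ))} {a d : ℤ × ℤ}
    (h : IsDominoTiling R T) (had : {a, d} ∈ T) :
    IsDominoTiling (R \ {a, d}) (T \ {{a, d}}) := by
  refine ⟨fun D hD => h.1 D hD.1, h.2.1.subset Set.sdiff_subset, ?_⟩
  ext x
  constructor
  · rintro ⟨D, ⟨hD, hne⟩, hx⟩
    refine ⟨h.subset hD hx, fun hx' => hne ?_⟩
    exact h.2.1.elim_set hD had x hx hx'
  · rintro ⟨hx, hx'⟩
    rw [← h.2.2] at hx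
    obtain ⟨D, hD, hxD⟩ := hx
    exact ⟨D, ⟨hD, fun hD' => hx' (hD' ▸ hxD)⟩, hxD⟩

theorem finite_setOf_isDominoTiling (R : Finset (ℤ × ℤ)) :
    {T : Set (Set (ℤ × ℤ)) | IsDominoTiling (R : Set (ℤ × ℤ)) T}.Finite := by
  refine (R.finite_toSet.finite_subsets.finite_subsets).subset fun T hT D hD => ?_
  exact hT.subset hD

theorem numDominoTilings_empty : numDominoTilings ∅ = 1 := by
  rw [numDominoTilings, Set.ncard_eq_one]
  refine ⟨∅, Set.eq_singleton_iff_unique_mem.2 ⟨⟨by simp, by simp, by simp⟩, fun T hT => ?_⟩⟩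
  refine Set.eq_empty_iff_forall_notMem.2 fun D hD => ?_
  obtain ⟨c, d, -, rfl⟩ := hT.1 D hD
  exact hT.subset hD (show c ∈ ({c, d} : Set _) by simp)

open Classical in
theorem numDominoTilings_expand (R : Finset (ℤ × ℤ)) (a : ℤ × ℤ) (ha : a ∈ R) :
    numDominoTilings (R : Set (ℤ × ℤ)) = ∑ d ∈ R with Adjoins a d,
      numDominoTilings (((R.erase a).erase d : Finset (ℤ × ℤ)) : Set (ℤ × ℤ)) := by
  have hcoe : ∀ d, (((R.erase a).erase d : Finset (ℤ × ℤ)) : Set (ℤ × ℤ)) =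
      (R : Set (ℤ × ℤ)) \ {a, d} := by
    intro d; ext x; simp; tauto
  -- Tilings are sorted by the partner `d` of `a`; deleting or restoring the domino `{a, d}` is a
  -- bijection with the tilings of the rest.
  have hkey : {T : Set (Set (ℤ × ℤ)) | IsDominoTiling (R : Set (ℤ × ℤ)) T} =
      ⋃ d ∈ R.filter (fun d => Adjoins a d), (fun T => insert {a, d} T) ''
        {T | IsDominoTiling ((R : Set (ℤ × ℤ)) \ {a, d}) T} := by
    ext T
    simp only [Set.mem_ofPred_eq, Set.mem_iUnion, Set.mem_image, Finset.mem_filter]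
    constructor
    · intro h
      obtain ⟨d, hd, had, hT⟩ := h.exists_partner ha
      exact ⟨d, ⟨hd, had⟩, _, h.diff_pair hT, Set.insert_sdiff_self_of_mem hT⟩
    · rintro ⟨d, ⟨hd, had⟩, T', hT', rfl⟩
      exact hT'.insert_pair ha hd had
  have hfin : ∀ d, {T | IsDominoTiling ((R : Set (ℤ × ℤ)) \ {a, d}) T}.Finite := fun d => by
    rw [← hcoe]; exact finite_setOf_isDominoTiling _
  unfold numDominoTilings
  rw [hkey]
  refine ((Finset.finite_toSet (R.filter fun d => Adjoins a d)).ncard_biUnion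
    (fun d _ => (hfin d).image _) ?_).trans ?_
  · intro d hd d' hd' hne
    have hd := Finset.mem_filter.1 (Finset.mem_coe.1 hd)
    refine Set.disjoint_left.2 ?_
    rintro _ ⟨T, hT, rfl⟩ ⟨T', hT', h⟩
    have h1 := hT.insert_pair ha hd.1 hd.2
    have h' : insert {a, d'} T' = insert {a, d} T := h
    exact hne (h1.eq_of_pair_mem (Set.mem_insert _ _) (h' ▸ Set.mem_insert _ _)
      fun h => not_adjoins_self a (h ▸ hd.2))
  · rw [finsum_mem_coe_finset]
    refine Finset.sum_congr rfl fun d _ => ?_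
    rw [hcoe, Set.InjOn.ncard_image]
    intro T hT T' hT' h
    have hn : ∀ T, IsDominoTiling ((R : Set (ℤ × ℤ)) \ {a, d}) T → {a, d} ∉ T := fun T hT h =>
      (hT.subset h (show a ∈ ({a, d} : Set _) by simp)).2 (by simp)
    have h' : insert {a, d} T = insert {a, d} T' := h
    rw [← Set.insert_sdiff_self_of_notMem (hn T hT), h', Set.insert_sdiff_self_of_notMem (hn T' hT')]

theorem isMatchingCount_numDominoTilings :
    IsMatchingCount Adjoins (fun R => (numDominoTilings (R : Set (ℤ × ℤ)) : ℚ)) where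
  empty := by simp [numDominoTilings_empty]
  expand R a ha := by
    classical
    rw [numDominoTilings_expand R a ha]
    push_cast
    rfl

/-! ### Products of differences -/

/-- The product of the differences `y - x` over all pairs `x < y` in `X`. -/
def diffProd (X : Finset ℤ) : ℚ := ∏ x ∈ X, ∏ y ∈ X with x < y, ((y : ℚ) - x)

@[simp]
theorem diffProd_empty : diffProd ∅ = 1 := rfl

theorem diffProd_insert {a : ℤ} {X : Finset ℤ} (ha : a ∉ X) :
    diffProd (insert a X) = diffProd X * ∏ y ∈ X, |(y : ℚ) - a| := by
  have h1 : ∀ x ∈ X, ∏ y ∈ insert a X with x < y, ((y : ℚ) - x) =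
      (∏ y ∈ X with x < y, ((y : ℚ) - x)) * if x < a then (a : ℚ) - x else 1 := by
    intro x _
    rw [Finset.filter_insert]
    split_ifs with h
    · rw [Finset.prod_insert (by simp [ha]), mul_comm]
    · rw [mul_one]
  have h2 : ∏ y ∈ insert a X with a < y, ((y : ℚ) - a) =
      ∏ y ∈ X, if a < y then (y : ℚ) - a else 1 := by
    rw [Finset.filter_insert, if_neg (lt_irrefl _), Finset.prod_filter]
  rw [diffProd, Finset.prod_insert ha, h2, Finset.prod_congr rfl h1, Finset.prod_mul_distrib,
    mul_left_comm, ← Finset.prod_mul_distrib, diffProd]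
  congr 1
  refine Finset.prod_congr rfl fun y hy => ?_
  have hne : y ≠ a := fun h => ha (h ▸ hy)
  rcases lt_or_gt_of_ne hne with h | h
  · have h' : (y : ℚ) < a := by exact_mod_cast h
    rw [if_neg h.not_gt, if_pos h, abs_of_neg (by linarith)]
    ring
  · have h' : (a : ℚ) < y := by exact_mod_cast h
    rw [if_pos h, if_neg h.not_gt, abs_of_pos (by linarith), mul_one]

theorem diffProd_image_of_strictMono {n : ℕ} {t : Fin n → ℤ} (ht : StrictMono t) :
    diffProd (Finset.univ.image t) = (Matrix.vandermonde fun i => (t i : ℚ)).det := by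
  rw [Matrix.det_vandermonde, diffProd, Finset.prod_image ht.injective.injOn]
  refine Finset.prod_congr rfl fun i _ => ?_
  rw [Finset.filter_image, Finset.prod_image ht.injective.injOn]
  refine Finset.prod_congr ?_ fun _ _ => rfl
  ext j
  simp [ht.lt_iff_lt]

theorem diffProd_image_add (X : Finset ℤ) (c : ℤ) :
    diffProd (X.image (· + c)) = diffProd X := by
  have hinj : Set.InjOn (· + c) (X : Set ℤ) := fun _ _ _ _ h => add_right_cancel h
  rw [diffProd, Finset.prod_image hinj]
  refine Finset.prod_congr rfl fun x _ => ?_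
  rw [Finset.filter_image, Finset.prod_image (hinj.mono fun _ h => (Finset.mem_filter.1 h).1)]
  refine Finset.prod_congr (by ext; simp) fun y _ => ?_
  push_cast
  ring

/-- Write Δ for `diffProd` and c for the product of the distances between `X` and `B \ X`. Then Δ(B)
= Δ(X) Δ(B \ X) c, while the distances from each point of `X` to the rest of `B` multiply to Δ(X)²
c. Hence passing to a complement only introduces a weight at each point. -/
theorem diffProd_sdiff {X B : Finset ℤ} (h : X ⊆ B) :
    diffProd (B \ X) = diffProd B * diffProd X * ∏ x ∈ X, (∏ y ∈ B.erase x, |(y : ℚ) - x|)⁻¹ := by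
  induction X using Finset.induction_on with
  | empty => simp
  | insert a X ha ih =>
    have haB : a ∈ B := h (Finset.mem_insert_self _ _)
    have hX : X ⊆ B := fun x hx => h (Finset.mem_insert_of_mem hx)
    have h1 : B \ X = insert a (B \ insert a X) := by
      rw [Finset.sdiff_insert, Finset.insert_erase (Finset.mem_sdiff.2 ⟨haB, ha⟩)]
    have h2 : B.erase a = X ∪ (B \ insert a X) := by
      ext y
      simp only [Finset.mem_erase, Finset.mem_union, Finset.mem_sdiff, Finset.mem_insert, not_or]
      constructor
      · rintro ⟨h3, h4⟩
        by_cases h5 : y ∈ X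
        · exact Or.inl h5
        · exact Or.inr ⟨h4, h3, h5⟩
      · rintro (h3 | ⟨h4, h3, -⟩)
        · exact ⟨fun h => ha (h ▸ h3), hX h3⟩
        · exact ⟨h3, h4⟩
    have hdis : Disjoint X (B \ insert a X) :=
      Finset.disjoint_left.2 fun x hx hx' =>
        (Finset.mem_sdiff.1 hx').2 (Finset.mem_insert_of_mem hx)
    have hpos : ∀ Z : Finset ℤ, a ∉ Z → (∏ y ∈ Z, |(y : ℚ) - a|) ≠ 0 := fun Z hZ => by
      refine Finset.prod_ne_zero_iff.2 fun y hy => abs_ne_zero.2 (sub_ne_zero.2 ?_)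
      exact_mod_cast fun h : y = a => hZ (h ▸ hy)
    have ih := ih hX
    rw [h1, diffProd_insert (by simp)] at ih
    rw [diffProd_insert ha, Finset.prod_insert ha, h2, Finset.prod_union hdis]
    have e1 := hpos X ha
    have e2 := hpos (B \ insert a X) (by simp)
    rw [eq_comm, ← mul_right_cancel_iff_of_pos (α := ℚ)
      (lt_of_le_of_ne (Finset.prod_nonneg fun y _ => abs_nonneg _) e2.symm), ih]
    field_simp

theorem prod_Icc_erase_abs_sub {lo hi x : ℤ} (h1 : lo ≤ x) (h2 : x ≤ hi) :
    ∏ y ∈ (Finset.Icc lo hi).erase x, |(y : ℚ) - x| =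
      ((x - lo).toNat.factorial : ℚ) * (hi - x).toNat.factorial := by
  have hsplit : (Finset.Icc lo hi).erase x = Finset.Ico lo x ∪ Finset.Ioc x hi := by
    ext y
    simp only [Finset.mem_erase, Finset.mem_Icc, Finset.mem_union, Finset.mem_Ico, Finset.mem_Ioc]
    omega
  have hdis : Disjoint (Finset.Ico lo x) (Finset.Ioc x hi) := by
    refine Finset.disjoint_left.2 fun y hy hy' => ?_
    simp only [Finset.mem_Ico, Finset.mem_Ioc] at hy hy'
    omega
  rw [hsplit, Finset.prod_union hdis]
  congr 1
  · obtain ⟨n, rfl⟩ : ∃ n : ℕ, lo = x - n := ⟨(x - lo).toNat, by omega⟩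
    rw [show (x - (x - (n : ℤ))).toNat = n by omega]
    clear hsplit hdis h1
    induction n with
    | zero => simp
    | succ n ih =>
      have : Finset.Ico (x - ((n + 1 : ℕ) : ℤ)) x =
          insert (x - ((n + 1 : ℕ) : ℤ)) (Finset.Ico (x - (n : ℤ)) x) := by
        ext y; simp only [Finset.mem_Ico, Finset.mem_insert]; omega
      rw [this, Finset.prod_insert (by simp; omega), ih, Nat.factorial_succ]
      push_cast
      rw [show (x : ℚ) - (n + 1) - x = -(n + 1) by ring, abs_neg, abs_of_nonneg (by positivity)]
  · obtain ⟨n, rfl⟩ : ∃ n : ℕ, hi = x + n := ⟨(hi - x).toNat, by omega⟩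
    rw [show (x + (n : ℤ) - x).toNat = n by omega]
    clear hsplit hdis h2
    induction n with
    | zero => simp
    | succ n ih =>
      have : Finset.Ioc x (x + ((n + 1 : ℕ) : ℤ)) =
          insert (x + ((n + 1 : ℕ) : ℤ)) (Finset.Ioc x (x + n)) := by
        ext y; simp only [Finset.mem_Ioc, Finset.mem_insert]; omega
      rw [this, Finset.prod_insert (by simp), ih, Nat.factorial_succ]
      push_cast
      rw [show (x : ℚ) + (n + 1) - x = n + 1 by ring, abs_of_nonneg (by positivity)]

theorem diffProd_Icc_succ {lo hi : ℤ} (h : lo ≤ hi + 1) :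
    diffProd (Finset.Icc lo (hi + 1)) =
      diffProd (Finset.Icc lo hi) * ((hi + 1 - lo).toNat.factorial : ℚ) := by
  have : Finset.Icc lo (hi + 1) = insert (hi + 1) (Finset.Icc lo hi) := by
    ext y; simp only [Finset.mem_Icc, Finset.mem_insert]; omega
  have h2 := prod_Icc_erase_abs_sub (lo := lo) (hi := hi + 1) h le_rfl
  rw [this, Finset.erase_insert (by simp)] at h2
  rw [this, diffProd_insert (by simp), h2]
  simp

/-! ### Vandermonde determinants summed over unit shifts -/

open Polynomial in
theorem det_eval_eq_prod_coeff_mul_det_vandermonde {n : ℕ} (v : Fin n → ℚ) (P : ℕ → ℚ[X])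
    (hP : ∀ j, (P j).natDegree ≤ j) :
    (Matrix.of fun i j : Fin n => (P j).eval (v i)).det =
      (∏ j ∈ Finset.range n, (P j).coeff j) * (Matrix.vandermonde v).det := by
  rw [Matrix.eval_matrixOfPolynomials_eq_vandermonde_mul_matrixOfPolynomials v (fun j => P j)
    (fun j => hP j), Matrix.det_mul, Matrix.det_of_isUpperTriangular
    (Matrix.matrixOfPolynomials_blockTriangular (fun j : Fin n => P j) fun j => hP j), mul_comm]
  simp [Finset.prod_range]

/-- The positions `s`, with those indexed by `D` moved up by one. -/
def shiftOn {ι : Type*} [DecidableEq ι] (s : ι → ℤ) (D : Finset ι) (i : ι) : ℤ :=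
  s i + if i ∈ D then 1 else 0

-- The determinant is additive in each row, so the sum over all choices of "stay" or "move up" is
-- one determinant with rows `ω (s i)` times the values of `P j` at `s i`. That matrix is, up to row
-- factors, a Vandermonde matrix times a triangular matrix of coefficients.
open Polynomial in
theorem sum_shiftOn_det_vandermonde {n : ℕ} (s : Fin n → ℤ) (w ω : ℤ → ℚ) (P : ℕ → ℚ[X])
    (hP : ∀ j, (P j).natDegree ≤ j)
    (hw : ∀ i j, w (s i) * (s i : ℚ) ^ j + w (s i + 1) * ((s i : ℚ) + 1) ^ j =
      ω (s i) * (P j).eval (s i : ℚ)) :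
    ∑ D : Finset (Fin n), (∏ i, w (shiftOn s D i)) *
        (Matrix.vandermonde fun i => (shiftOn s D i : ℚ)).det =
      (∏ i, ω (s i)) * (∏ j ∈ Finset.range n, (P j).coeff j) *
        (Matrix.vandermonde fun i => (s i : ℚ)).det := by
  have h1 := (Matrix.detRowAlternating (n := Fin n) (R := ℚ)).toMultilinearMap.map_add_univ
    (fun i (j : Fin n) => w (s i + 1) * ((s i : ℚ) + 1) ^ (j : ℕ))
    (fun i (j : Fin n) => w (s i) * (s i : ℚ) ^ (j : ℕ))
  have h2 : ((fun i (j : Fin n) => w (s i + 1) * ((s i : ℚ) + 1) ^ (j : ℕ)) +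
      (fun i (j : Fin n) => w (s i) * (s i : ℚ) ^ (j : ℕ)) : Fin n → Fin n → ℚ) =
      fun i (j : Fin n) => ω (s i) * (P j).eval (s i : ℚ) := by
    ext i j
    rw [← hw, add_comm]
    rfl
  rw [h2] at h1
  have h3 := Matrix.det_mul_column (fun i => ω (s i))
    (Matrix.of fun i j : Fin n => (P j).eval (s i : ℚ))
  rw [det_eval_eq_prod_coeff_mul_det_vandermonde _ P hP, ← mul_assoc] at h3
  rw [← h3]
  refine Eq.trans (Finset.sum_congr rfl fun D _ => ?_) h1.symm
  rw [← Matrix.det_mul_column]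
  refine congrArg Matrix.det ?_
  ext i j
  simp only [Matrix.of_apply, Matrix.vandermonde_apply, shiftOn, Finset.piecewise]
  split_ifs <;> simp

/-! ### Peeling off the lowest row -/

/-- Adjacency of unit squares, for the square with lower left corner `c` written as
`(c.1 + c.2, c.2)`. -/
def RowAdj (a b : ℤ × ℤ) : Prop :=
  (b.1 = a.1 + 1 ∧ (b.2 = a.2 ∨ b.2 = a.2 + 1)) ∨ (a.1 = b.1 + 1 ∧ (a.2 = b.2 ∨ a.2 = b.2 + 1))

theorem RowAdj.irrefl (a : ℤ × ℤ) : ¬ RowAdj a a := by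
  simp [RowAdj]

section Peel

variable {ι : Type*}

open Classical in
/-- The number of matchings of `Q` left once the vertices `(u, φ i)`, `i ∈ J`, are used up; it is
zero if these are not distinct vertices of `Q`. -/
noncomputable def countAfter (M : Finset (ℤ × ℤ) → ℚ) (u : ℤ) (φ : ι → ℤ) (J : Finset ι)
    (Q : Finset (ℤ × ℤ)) : ℚ :=
  if Set.InjOn φ (J : Set ι) ∧ ∀ i ∈ J, (u, φ i) ∈ Q then M (Q \ ({u} ×ˢ J.image φ)) else 0

theorem countAfter_congr (M : Finset (ℤ × ℤ) → ℚ) (u : ℤ) {φ ψ : ι → ℤ} {J : Finset ι}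
    (Q : Finset (ℤ × ℤ)) (h : ∀ i ∈ J, φ i = ψ i) :
    countAfter M u φ J Q = countAfter M u ψ J Q := by
  have h1 : Set.InjOn φ (J : Set ι) ↔ Set.InjOn ψ (J : Set ι) := Set.EqOn.injOn_iff h
  have h2 : (∀ i ∈ J, (u, φ i) ∈ Q) ↔ ∀ i ∈ J, (u, ψ i) ∈ Q :=
    forall₂_congr fun i hi => by rw [h i hi]
  simp only [countAfter, h1, h2, Finset.image_congr h]

variable [DecidableEq ι]

theorem countAfter_insert (M : Finset (ℤ × ℤ) → ℚ) (u : ℤ) (φ : ι → ℤ) {J : Finset ι} {j : ι}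
    (hj : j ∉ J) (Q : Finset (ℤ × ℤ)) :
    countAfter M u φ (insert j J) Q =
      if (u, φ j) ∈ Q then countAfter M u φ J (Q.erase (u, φ j)) else 0 := by
  classical
  have h1 : (Set.InjOn φ ((insert j J : Finset ι) : Set ι) ∧ ∀ i ∈ insert j J, (u, φ i) ∈ Q) ↔
      (u, φ j) ∈ Q ∧ Set.InjOn φ (J : Set ι) ∧ ∀ i ∈ J, (u, φ i) ∈ Q.erase (u, φ j) := by
    rw [Finset.coe_insert, Set.injOn_insert (by simpa using hj)]
    simp only [Finset.mem_insert, forall_eq_or_imp, Finset.mem_erase, Set.mem_image, not_exists,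
      Finset.mem_coe, ne_eq, Prod.mk.injEq, true_and, not_and]
    constructor
    · rintro ⟨⟨h1, h2⟩, h3, h4⟩
      exact ⟨h3, h1, fun i hi => ⟨h2 i hi, h4 i hi⟩⟩
    · rintro ⟨h3, h1, h2⟩
      exact ⟨⟨h1, fun i hi => (h2 i hi).1⟩, h3, fun i hi => (h2 i hi).2⟩
  have h2 : Q \ ({u} ×ˢ (insert j J).image φ) = Q.erase (u, φ j) \ ({u} ×ˢ J.image φ) := by
    ext ⟨a, b⟩
    simp only [Finset.mem_sdiff, Finset.mem_product, Finset.mem_singleton, Finset.image_insert,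
      Finset.mem_insert, Finset.mem_erase, ne_eq, Prod.mk.injEq]
    tauto
  rw [countAfter, h2]
  by_cases h : (u, φ j) ∈ Q
  · rw [if_pos h, countAfter]
    simp only [h1, h, true_and]
  · rw [if_neg h, if_neg (fun h' => h (h1.1 h').1)]

variable {M : Finset (ℤ × ℤ) → ℚ}

theorem expand_lowest_square (hM : IsMatchingCount RowAdj M) (u y : ℤ) (X : Finset ℤ) (hy : y ∉ X)
    (Q : Finset (ℤ × ℤ)) (hQ : ∀ q ∈ Q, u < q.1) :
    M ({u} ×ˢ insert y X ∪ Q) =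
      (if (u + 1, y) ∈ Q then M ({u} ×ˢ X ∪ Q.erase (u + 1, y)) else 0) +
        if (u + 1, y + 1) ∈ Q then M ({u} ×ˢ X ∪ Q.erase (u + 1, y + 1)) else 0 := by
  classical
  have h1 : ({u} ×ˢ insert y X ∪ Q : Finset (ℤ × ℤ)) = insert (u, y) (Q ∪ {u} ×ˢ X) := by
    ext ⟨a, b⟩
    simp only [Finset.mem_union, Finset.mem_product, Finset.mem_singleton, Finset.mem_insert,
      Prod.mk.injEq]
    tauto
  rw [h1, hM.expand_insert RowAdj.irrefl (fun h => lt_irrefl _ (hQ _ h)) (by simpa using hy)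
    (Finset.disjoint_left.2 fun q hq hq' => (hQ q hq).ne'
      (Finset.mem_singleton.1 (Finset.mem_product.1 hq').1))
    (by simp [RowAdj])]
  have h2 : Q.filter (fun d => RowAdj (u, y) d) =
      (({(u + 1, y), (u + 1, y + 1)} : Finset (ℤ × ℤ)).filter (· ∈ Q)) := by
    ext ⟨a, b⟩
    simp only [Finset.mem_filter, Finset.mem_insert, Finset.mem_singleton, Prod.mk.injEq]
    constructor
    · rintro ⟨h, ⟨h3, h4⟩ | ⟨h3, h4⟩⟩
      · exact ⟨h4.imp (fun h => ⟨h3, h⟩) (fun h => ⟨h3, h⟩), h⟩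
      · have := hQ _ h
        simp only at this
        omega
    · rintro ⟨h3, h⟩
      exact ⟨h, Or.inl (by tauto)⟩
  rw [h2, Finset.sum_filter, Finset.sum_pair (by simp)]
  simp only [Finset.union_comm]

/-- Each square of the row chooses its upper partner independently, `D` being the set that moves up
by one. Choices that collide or leave `Q` are kept in the sum and contribute zero through
`countAfter`, so the sum runs over all subsets. -/
theorem expand_lowest_row (hM : IsMatchingCount RowAdj M) (u : ℤ) (s : ι → ℤ) (J : Finset ι) :
    ∀ Q : Finset (ℤ × ℤ), Set.InjOn s (J : Set ι) → (∀ q ∈ Q, u < q.1) →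
      M ({u} ×ˢ J.image s ∪ Q) = ∑ D ∈ J.powerset, countAfter M (u + 1) (shiftOn s D) J Q := by
  induction J using Finset.induction_on with
  | empty => intro Q _ _; simp [countAfter]
  | insert j J hj ih =>
    intro Q hs hQ
    rw [Finset.coe_insert, Set.injOn_insert (by simpa using hj)] at hs
    have hsj : s j ∉ J.image s := by simpa using hs.2
    rw [Finset.image_insert, expand_lowest_square hM u _ _ hsj Q hQ, Finset.sum_powerset_insert hj]
    have hQ' : ∀ p, ∀ q ∈ Q.erase p, u < q.1 := fun p q hq => hQ q (Finset.mem_of_mem_erase hq)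
    rw [ih _ hs.1 (hQ' _), ih _ hs.1 (hQ' _)]
    congr 1
    · split_ifs with h
      · refine Finset.sum_congr rfl fun D hD => ?_
        have hjD : j ∉ D := fun h => hj (Finset.mem_powerset.1 hD h)
        have : shiftOn s D j = s j := by simp [shiftOn, hjD]
        rw [countAfter_insert M _ _ hj, this, if_pos h]
      · refine (Finset.sum_eq_zero fun D hD => ?_).symm
        have hjD : j ∉ D := fun h => hj (Finset.mem_powerset.1 hD h)
        have : shiftOn s D j = s j := by simp [shiftOn, hjD]
        rw [countAfter_insert M _ _ hj, this, if_neg h]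
    · have hc : ∀ D, ∀ i ∈ J, shiftOn s (insert j D) i = shiftOn s D i := fun D i hi => by
        have : i ≠ j := fun h => hj (h ▸ hi)
        simp [shiftOn, this]
      split_ifs with h
      · refine Finset.sum_congr rfl fun D hD => ?_
        have : shiftOn s (insert j D) j = s j + 1 := by simp [shiftOn]
        rw [countAfter_insert M _ _ hj, this, if_pos h, countAfter_congr _ _ _ (hc D)]
      · refine (Finset.sum_eq_zero fun D hD => ?_).symm
        have : shiftOn s (insert j D) j = s j + 1 := by simp [shiftOn]
        rw [countAfter_insert M _ _ hj, this, if_neg h]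

end Peel

open Polynomial in
/-- If the matchings of `Q` with part `T` of its lowest row removed are counted by a weighted
product of differences, then so are the matchings of `Q` with a row below it. -/
theorem count_insert_row {M : Finset (ℤ × ℤ) → ℚ} (hM : IsMatchingCount RowAdj M) (u : ℤ)
    (S : Finset ℤ) (Q : Finset (ℤ × ℤ)) (hQ : ∀ q ∈ Q, u < q.1) (κ : ℚ) (w ω : ℤ → ℚ)
    (P : ℕ → ℚ[X]) (hP : ∀ j, (P j).natDegree ≤ j)
    (hw : ∀ y ∈ S, ∀ j, w y * (y : ℚ) ^ j + w (y + 1) * ((y : ℚ) + 1) ^ j =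
      ω y * (P j).eval (y : ℚ))
    (hQw : ∀ y ∈ S, (w y ≠ 0 → (u + 1, y) ∈ Q) ∧ (w (y + 1) ≠ 0 → (u + 1, y + 1) ∈ Q))
    (hT : ∀ T : Finset ℤ, T.card = S.card → (∀ y ∈ T, (u + 1, y) ∈ Q) →
      M (Q \ ({u + 1} ×ˢ T)) = κ * diffProd T * ∏ y ∈ T, w y) :
    M ({u} ×ˢ S ∪ Q) =
      κ * (∏ y ∈ S, ω y) * (∏ j ∈ Finset.range S.card, (P j).coeff j) * diffProd S := by
  obtain ⟨n, hn⟩ : ∃ n, S.card = n := ⟨_, rfl⟩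
  let s : Fin n → ℤ := S.orderEmbOfFin hn
  have hs : StrictMono s := (S.orderEmbOfFin hn).strictMono
  have hsS : Finset.univ.image s = S := by
    apply Finset.coe_injective
    rw [Finset.coe_image, Finset.coe_univ, Set.image_univ]
    exact Finset.range_orderEmbOfFin S hn
  have hmem : ∀ i, s i ∈ S := fun i => S.orderEmbOfFin_mem hn i
  have hprod : ∀ f : ℤ → ℚ, ∏ y ∈ S, f y = ∏ i, f (s i) := fun f => by
    rw [← hsS, Finset.prod_image hs.injective.injOn]
  have hkey := sum_shiftOn_det_vandermonde s w ω P hP (fun i j => hw _ (hmem i) j)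
  rw [hn, hprod, ← hsS, diffProd_image_of_strictMono hs, mul_assoc, mul_assoc, ← mul_assoc (∏ i, _),
    ← hkey, expand_lowest_row hM u s Finset.univ Q hs.injective.injOn hQ, Finset.powerset_univ,
    Finset.mul_sum]
  refine Finset.sum_congr rfl fun D _ => ?_
  rw [countAfter]
  split_ifs with h
  · obtain ⟨hinj, hmemQ⟩ := h
    have hinj : Function.Injective (shiftOn s D) := by
      rwa [Finset.coe_univ, Set.injOn_univ] at hinj
    have hmono : StrictMono (shiftOn s D) := by
      -- Increasing integers that move up by at most one stay weakly increasing. So an injective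
      -- shift is increasing, and its Vandermonde determinant is `diffProd` with the right sign.
      refine Monotone.strictMono_of_injective (fun i j hij => ?_) hinj
      rcases hij.eq_or_lt with rfl | hlt
      · exact le_rfl
      · have := hs hlt
        simp only [shiftOn]
        split_ifs <;> omega
    rw [hT _ _ _, diffProd_image_of_strictMono hmono, Finset.prod_image hinj.injOn]
    · ring
    · rw [Finset.card_image_of_injective _ hinj, hn, Finset.card_univ, Fintype.card_fin]
    · intro y hy
      obtain ⟨i, hi, rfl⟩ := Finset.mem_image.1 hy
      exact hmemQ i hi
  -- An inadmissible choice also vanishes on the determinant side: a position outside `Q` has weight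
  -- zero, and a collision gives two equal rows.
  · by_cases hinj : Function.Injective (shiftOn s D)
    · have h' : ∃ i, (u + 1, shiftOn s D i) ∉ Q := by
        by_contra hcon
        push Not at hcon
        exact h ⟨hinj.injOn, fun i _ => hcon i⟩
      obtain ⟨i, hi⟩ := h'
      have : w (shiftOn s D i) = 0 := by
        by_contra hne
        refine hi ?_
        unfold shiftOn at hne ⊢
        split_ifs at hne ⊢ with hD
        · exact (hQw _ (hmem i)).2 hne
        · rw [add_zero] at hne ⊢
          exact (hQw _ (hmem i)).1 hne
      rw [Finset.prod_eq_zero (Finset.mem_univ i) this]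
      ring
    · have : (Matrix.vandermonde fun i => (shiftOn s D i : ℚ)).det = 0 := by
        by_contra hne
        rw [← ne_eq, Matrix.det_vandermonde_ne_zero_iff] at hne
        exact hinj fun i j hij => hne (by simp [hij])
      rw [this]
      ring

/-! ### The polynomials for odd and even rows -/

section RowPolynomials

open Polynomial

theorem natDegree_X_pow_add_le (j : ℕ) : ((X : ℚ[X]) ^ j + (X + 1) ^ j).natDegree ≤ j := by
  rw [natDegree_le_iff_coeff_eq_zero]
  intro N hN
  rw [coeff_add, coeff_X_pow, coeff_X_add_one_pow, Nat.choose_eq_zero_of_lt hN, if_neg hN.ne']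
  simp

theorem coeff_X_pow_add (j : ℕ) : ((X : ℚ[X]) ^ j + (X + 1) ^ j).coeff j = 2 := by
  rw [coeff_add, coeff_X_pow, coeff_X_add_one_pow, Nat.choose_self, if_pos rfl]
  norm_num

theorem coeff_succ_balanced (a b : ℚ) (j N : ℕ) :
    ((X - C a) * (X : ℚ[X]) ^ j + (C b - X) * (X + 1) ^ j).coeff (N + 1) =
      (if N = j then 1 else 0) - a * (if N + 1 = j then 1 else 0) + b * (j.choose (N + 1)) -
        j.choose N := by
  rw [coeff_add, sub_mul, sub_mul, coeff_sub, coeff_sub, coeff_X_mul, coeff_X_mul, coeff_C_mul,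
    coeff_C_mul, coeff_X_pow, coeff_X_pow, coeff_X_add_one_pow, coeff_X_add_one_pow]
  ring

/-- The two terms of degree `j + 1` cancel, which is what makes `count_insert_row` applicable to
even rows. -/
theorem natDegree_balanced_le (a b : ℚ) (j : ℕ) :
    ((X - C a) * (X : ℚ[X]) ^ j + (C b - X) * (X + 1) ^ j).natDegree ≤ j := by
  rw [natDegree_le_iff_coeff_eq_zero]
  intro N hN
  obtain ⟨N, rfl⟩ : ∃ i, N = i + 1 := ⟨N - 1, by omega⟩
  rw [coeff_succ_balanced, Nat.choose_eq_zero_of_lt hN, if_neg hN.ne']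
  rcases (Nat.lt_succ_iff.1 hN).eq_or_lt with rfl | h
  · simp
  · rw [Nat.choose_eq_zero_of_lt h, if_neg h.ne']
    simp

theorem coeff_balanced (a b : ℚ) (j : ℕ) :
    ((X - C a) * (X : ℚ[X]) ^ j + (C b - X) * (X + 1) ^ j).coeff j = b - a - j := by
  rcases j with _ | j
  · simp
  · rw [coeff_succ_balanced, Nat.choose_self, Nat.choose_succ_self_right, if_neg (by omega),
      if_pos rfl]
    push_cast
    ring

end RowPolynomials

theorem prod_range_sub_mul_factorial {N n : ℕ} (h : n ≤ N) :
    (∏ j ∈ Finset.range (N - n), ((N : ℚ) - j)) * (n.factorial : ℚ) = N.factorial := by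
  induction h using Nat.decreasingInduction with
  | self => simp
  | of_succ n hn ih =>
    rw [show N - n = N - (n + 1) + 1 by omega, Finset.prod_range_succ, ← ih, Nat.factorial_succ]
    rw [Nat.cast_sub (by omega : n + 1 ≤ N)]
    push_cast
    ring

/-! ### Tilings of dented Aztec rectangles -/

/-- The squares of the `2k-1` by `2k` undented Aztec rectangle, in the coordinates of `RowAdj`. -/
noncomputable def rowRegion (k : ℕ) : Finset (ℤ × ℤ) :=
  (Finset.Icc (-(2 * k : ℤ)) (2 * k) ×ˢ Finset.Icc (-(2 * k : ℤ)) (2 * k)).filter fun p =>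
    -(2 * k - 1 : ℤ) ≤ p.1 ∧ p.1 ≤ 2 * k - 1 ∧ -(2 * k : ℤ) ≤ 2 * p.2 - p.1 ∧
      2 * p.2 - p.1 ≤ 2 * k

theorem mem_rowRegion {k : ℕ} {u y : ℤ} : (u, y) ∈ rowRegion k ↔
    -(2 * k - 1 : ℤ) ≤ u ∧ u ≤ 2 * k - 1 ∧ -(2 * k : ℤ) ≤ 2 * y - u ∧ 2 * y - u ≤ 2 * k := by
  simp only [rowRegion, Finset.mem_filter, Finset.mem_product, Finset.mem_Icc]
  omega

/-- The squares of the region in rows above `u`. -/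
noncomputable def rowsAbove (k : ℕ) (u : ℤ) : Finset (ℤ × ℤ) := (rowRegion k).filter fun p => u < p.1

theorem mem_rowsAbove {k : ℕ} {u v y : ℤ} : (v, y) ∈ rowsAbove k u ↔ u < v ∧
    -(2 * k - 1 : ℤ) ≤ v ∧ v ≤ 2 * k - 1 ∧ -(2 * k : ℤ) ≤ 2 * y - v ∧ 2 * y - v ≤ 2 * k := by
  rw [rowsAbove, Finset.mem_filter, mem_rowRegion, and_comm]

/-- The number of tilings of a dented Aztec rectangle with `n` rows is `dentedConst n` times a
product of differences. -/
noncomputable def dentedConst : ℕ → ℚ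
  | 0 => 1
  | n + 1 => dentedConst n * 2 ^ (n + 1) / n.factorial

section DentedCount

variable {M : Finset (ℤ × ℤ) → ℚ}

/-- `E` is the part of row 2m used up from below. Its complement is matched to a set `T` in row 2m +
1, and the complement of `T` is what the induction hypothesis counts. Two applications of
`diffProd_sdiff` carry the products of differences from one complement to the other. -/
theorem count_even_row (hM : IsMatchingCount RowAdj M) {k n : ℕ} {m : ℤ} (hm : m = k - (n + 1 : ℕ))
    (hm0 : 0 ≤ m)
    (ih : ∀ S ⊆ Finset.Icc (m + 1 - k) (m + k), M ({2 * m + 1} ×ˢ S ∪ rowsAbove k (2 * m + 1)) =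
      if S.card = n then dentedConst n * diffProd S else 0)
    {E : Finset ℤ} (hE : E ⊆ Finset.Icc (m - k) (m + k)) :
    M (rowsAbove k (2 * m - 1) \ ({2 * m} ×ˢ E)) =
      if E.card = n + 1 then dentedConst n / n.factorial * diffProd E else 0 := by
  have hrow : rowsAbove k (2 * m - 1) \ ({2 * m} ×ˢ E) =
      {2 * m} ×ˢ (Finset.Icc (m - k) (m + k) \ E) ∪ rowsAbove k (2 * m) := by
    ext ⟨v, y⟩
    simp only [Finset.mem_sdiff, Finset.mem_union, Finset.mem_product, Finset.mem_singleton,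
      mem_rowsAbove, Finset.mem_Icc]
    by_cases hy : y ∈ E
    · simp only [hy, not_true_eq_false, and_false, false_or, and_true]
      omega
    · simp only [hy, not_false_eq_true, and_true, and_false]
      omega
  have hcardI : (Finset.Icc (m - k) (m + k)).card = 2 * k + 1 := by
    rw [Int.card_Icc]; omega
  have hcardO : (Finset.Icc (m + 1 - k) (m + k)).card = 2 * k := by
    rw [Int.card_Icc]; omega
  have hcardE := Finset.card_sdiff_of_subset hE
  have hEle := Finset.card_le_card hE
  rw [hcardI] at hcardE hEle
  have hshift : diffProd (Finset.Icc (m + 1 - k) (m + k)) * ((2 * k).factorial : ℚ) =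
      diffProd (Finset.Icc (m - k) (m + k)) := by
    have h1 := diffProd_Icc_succ (lo := m - k) (hi := m + k - 1) (by omega)
    rw [show m + (k : ℤ) - 1 + 1 - (m - k) = ((2 * k : ℕ) : ℤ) by push_cast; ring, Int.toNat_natCast,
      sub_add_cancel] at h1
    rw [h1, ← diffProd_image_add (Finset.Icc (m - k) (m + k - 1)) 1, Finset.image_add_right_Icc]
    congr 3 <;> ring
  rw [hrow, count_insert_row hM (2 * m) _ (rowsAbove k (2 * m)) ?_
    ((if E.card = n + 1 then dentedConst n else 0) * diffProd (Finset.Icc (m + 1 - k) (m + k)))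
    -- The weight comes from `diffProd_sdiff` in the odd row. It is zero outside that row, since the
    -- end squares of the longer even row have only one upper neighbor.
    (fun t => if t ∈ Finset.Icc (m + 1 - k) (m + k) then
      (((t - (m + 1 - k)).toNat.factorial : ℚ) * (m + k - t).toNat.factorial)⁻¹ else 0)
    (fun y => (((y - (m - k)).toNat.factorial : ℚ) * (m + k - y).toNat.factorial)⁻¹)
    -- If w is the weight and ω the same expression for the even row, then w(y) = (y - (m - k)) ω(y)
    -- and w(y + 1) = (m + k - y) ω(y), also at the two ends.
    (fun j => (Polynomial.X - Polynomial.C ((m : ℚ) - k)) * Polynomial.X ^ j +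
      (Polynomial.C ((m : ℚ) + k) - Polynomial.X) * (Polynomial.X + 1) ^ j)
    (fun j => natDegree_balanced_le _ _ j)]
  · have h1 := diffProd_sdiff (X := Finset.Icc (m - k) (m + k) \ E) Finset.sdiff_subset
    rw [Finset.sdiff_sdiff_eq_self hE] at h1
    have h2 : ∏ x ∈ Finset.Icc (m - (k : ℤ)) (m + k) \ E,
        (∏ y ∈ (Finset.Icc (m - (k : ℤ)) (m + k)).erase x, |(y : ℚ) - x|)⁻¹ =
        ∏ x ∈ Finset.Icc (m - (k : ℤ)) (m + k) \ E,
          (((x - (m - k)).toNat.factorial : ℚ) * (m + k - x).toNat.factorial)⁻¹ := by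
      refine Finset.prod_congr rfl fun x hx => ?_
      have hx := Finset.mem_Icc.1 (Finset.sdiff_subset hx)
      rw [prod_Icc_erase_abs_sub hx.1 hx.2]
    rw [h2, ← hshift] at h1
    simp only [coeff_balanced]
    split_ifs with hc
    -- The coefficients 2k - j for j < 2k - n multiply to (2k)!/n!; the (2k)! cancels against
    -- `hshift`, leaving the 1/n!.
    · rw [h1, hcardE, hc, show 2 * k + 1 - (n + 1) = 2 * k - n by omega,
        ← prod_range_sub_mul_factorial (show n ≤ 2 * k by omega)]
      have h3 : ∀ j : ℕ, ((m : ℚ) + k - (m - k) - j) = ((2 * k : ℕ) : ℚ) - j := fun j => by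
        push_cast; ring
      simp only [h3]
      have h4 : (n.factorial : ℚ) ≠ 0 := by positivity
      field_simp
    · ring
  · intro y hy j
    have hy := Finset.mem_Icc.1 (Finset.sdiff_subset hy)
    simp only [Polynomial.eval_add, Polynomial.eval_mul, Polynomial.eval_sub, Polynomial.eval_X,
      Polynomial.eval_C, Polynomial.eval_pow, Polynomial.eval_one, mul_add]
    rw [← mul_assoc, ← mul_assoc]
    congr 2
    · obtain ⟨i, hi⟩ : ∃ i : ℕ, y - (m - k) = i := ⟨(y - (m - k)).toNat, by omega⟩
      have hi' : (y : ℚ) - (m - k) = i := by exact_mod_cast hi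
      rcases i with _ | i
      · rw [if_neg (by simp only [Finset.mem_Icc]; omega), hi']
        simp
      · rw [if_pos (by simp only [Finset.mem_Icc]; omega), hi', hi,
          show (y - (m + 1 - (k : ℤ))) = i by push_cast at hi; omega, Int.toNat_natCast,
          Int.toNat_natCast, Nat.factorial_succ]
        push_cast
        field_simp
    · obtain ⟨i, hi⟩ : ∃ i : ℕ, m + k - y = i := ⟨(m + k - y).toNat, by omega⟩
      have hi' : (m : ℚ) + k - y = i := by exact_mod_cast hi
      rcases i with _ | i
      · rw [if_neg (by simp only [Finset.mem_Icc]; omega), hi']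
        simp
      · rw [if_pos (by simp only [Finset.mem_Icc]; omega), hi', hi,
          show m + k - (y + 1) = (i : ℤ) by push_cast at hi; omega, Int.toNat_natCast,
          Int.toNat_natCast, Nat.factorial_succ, show y + 1 - (m + 1 - (k : ℤ)) = y - (m - k) by ring]
        push_cast
        field_simp
  · intro y hy
    simp only [Finset.mem_Icc, mem_rowsAbove, ne_eq, ite_eq_right_iff, Classical.not_imp]
    omega
  · intro T hTc hT
    have hTO : T ⊆ Finset.Icc (m + 1 - k) (m + k) := fun y hy => by
      have := mem_rowsAbove.1 (hT y hy)
      rw [Finset.mem_Icc]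
      omega
    have hrow' : rowsAbove k (2 * m) \ ({2 * m + 1} ×ˢ T) =
        {2 * m + 1} ×ˢ (Finset.Icc (m + 1 - k) (m + k) \ T) ∪ rowsAbove k (2 * m + 1) := by
      ext ⟨v, y⟩
      simp only [Finset.mem_sdiff, Finset.mem_union, Finset.mem_product, Finset.mem_singleton,
        mem_rowsAbove, Finset.mem_Icc]
      by_cases hy : y ∈ T
      · simp only [hy, not_true_eq_false, and_false, false_or, and_true]
        omega
      · simp only [hy, not_false_eq_true, and_true, and_false]
        omega
    have hTle := Finset.card_le_card hTO
    have hcT := Finset.card_sdiff_of_subset hTO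
    rw [hcardO] at hTle hcT
    have hiff : (Finset.Icc (m + 1 - (k : ℤ)) (m + k) \ T).card = n ↔ E.card = n + 1 := by omega
    rw [hrow', ih _ Finset.sdiff_subset, diffProd_sdiff hTO]
    simp only [hiff]
    have h2 : ∏ x ∈ T, (∏ y ∈ (Finset.Icc (m + 1 - (k : ℤ)) (m + k)).erase x, |(y : ℚ) - x|)⁻¹ =
        ∏ t ∈ T, if t ∈ Finset.Icc (m + 1 - (k : ℤ)) (m + k) then
          (((t - (m + 1 - k)).toNat.factorial : ℚ) * (m + k - t).toNat.factorial)⁻¹ else 0 := by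
      refine Finset.prod_congr rfl fun x hx => ?_
      have hx := hTO hx
      rw [if_pos hx, prod_Icc_erase_abs_sub (Finset.mem_Icc.1 hx).1 (Finset.mem_Icc.1 hx).2]
    rw [h2]
    split_ifs <;> ring
  · rintro ⟨v, y⟩ h
    exact (mem_rowsAbove.1 h).1

/-- The number of tilings of a dented Aztec rectangle. -/
theorem count_dented (hM : IsMatchingCount RowAdj M) (k : ℕ) :
    ∀ (n : ℕ) (m : ℤ), m = k - n → 0 ≤ m → ∀ S ⊆ Finset.Icc (m - k) (m + k - 1),
      M ({2 * m - 1} ×ˢ S ∪ rowsAbove k (2 * m - 1)) =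
        if S.card = n then dentedConst n * diffProd S else 0 := by
  intro n
  induction n with
  | zero =>
    intro m hm hm0 S hS
    have hempty : rowsAbove k (2 * m - 1) = ∅ := by
      ext ⟨v, y⟩
      simp only [mem_rowsAbove, Finset.notMem_empty, iff_false]
      omega
    rw [hempty]
    rcases S.eq_empty_or_nonempty with rfl | hne
    · simp [hM.empty, dentedConst]
    -- Above the top row there is nothing to match with, so zero weights suffice.
    · rw [if_neg hne.card_ne_zero, count_insert_row hM (2 * m - 1) S ∅ (by simp) 0 0 0 0
        (by simp) (by simp) (by simp)]
      · simp
      · intro T hT hT'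
        obtain ⟨y, hy⟩ : T.Nonempty := Finset.card_pos.1 (hT ▸ hne.card_pos)
        exact absurd (hT' y hy) (Finset.notMem_empty _)
  | succ n ih =>
    intro m hm hm0 S hS
    have hB := fun E hE => count_even_row hM hm hm0 (E := E) (fun S' hS' => by
      have := ih (m + 1) (by push_cast at hm; omega) (by omega) S'
        (by rwa [show m + 1 + (k : ℤ) - 1 = m + k by ring])
      rwa [show 2 * (m + 1) - 1 = 2 * m + 1 by ring] at this) hE
    -- For an odd row all weights are 1, and each leading coefficient of X^j + (X + 1)^j is 2.
    rw [count_insert_row hM (2 * m - 1) S (rowsAbove k (2 * m - 1)) ?_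
      (if S.card = n + 1 then dentedConst n / n.factorial else 0) 1 1
      (fun j => Polynomial.X ^ j + (Polynomial.X + 1) ^ j) natDegree_X_pow_add_le]
    · simp only [coeff_X_pow_add, Finset.prod_const, Finset.card_range]
      split_ifs with h
      · rw [h, dentedConst]
        simp only [Pi.one_apply, Finset.prod_const_one, mul_one]
        ring
      · simp
    · intro y _ j
      simp
    · intro y hy
      have hy := Finset.mem_Icc.1 (hS hy)
      simp only [mem_rowsAbove]
      omega
    · intro T hTc hT
      rw [sub_add_cancel] at hT ⊢
      rw [hB T, hTc]
      · split_ifs <;> simp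
      · intro y hy
        have := mem_rowsAbove.1 (hT y hy)
        rw [Finset.mem_Icc]
        omega
    · rintro ⟨v, y⟩ h
      exact (mem_rowsAbove.1 h).1

end DentedCount

/-! ### Cauchy–Binet and the sum over splittings -/

/-- The sum over the orderings of `S` of a term of the Cauchy–Binet expansion. -/
theorem sum_orderings_vandermonde {n : ℕ} {S : Finset ℤ} (hS : S.card = n) (X : Finset ℤ)
    (hSX : S ⊆ X) (w : ℤ → ℚ) :
    ∑ r ∈ Fintype.piFinset (fun _ : Fin n => X) with Finset.univ.image r = S,
        (∏ i, w (r i) * (r i : ℚ) ^ (i : ℕ)) * (Matrix.vandermonde fun i => (r i : ℚ)).det =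
      diffProd S ^ 2 * ∏ x ∈ S, w x := by
  let s : Fin n → ℤ := S.orderEmbOfFin hS
  have hs : StrictMono s := (S.orderEmbOfFin hS).strictMono
  have hsS : Finset.univ.image s = S := by
    apply Finset.coe_injective
    rw [Finset.coe_image, Finset.coe_univ, Set.image_univ]
    exact Finset.range_orderEmbOfFin S hS
  have hmem : ∀ i, s i ∈ S := fun i => S.orderEmbOfFin_mem hS i
  have h1 : ∑ r ∈ Fintype.piFinset (fun _ : Fin n => X) with Finset.univ.image r = S,
        (∏ i, w (r i) * (r i : ℚ) ^ (i : ℕ)) * (Matrix.vandermonde fun i => (r i : ℚ)).det =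
      ∑ σ : Equiv.Perm (Fin n), (∏ i, w (s (σ i)) * (s (σ i) : ℚ) ^ (i : ℕ)) *
        (Matrix.vandermonde fun i => (s (σ i) : ℚ)).det := by
    symm
    refine Finset.sum_bij (fun σ _ => fun i => s (σ i)) ?_ ?_ ?_ ?_
    · intro σ _
      rw [Finset.mem_filter, Fintype.mem_piFinset]
      refine ⟨fun i => hSX (hmem _), ?_⟩
      rw [← hsS]
      ext y
      simp only [Finset.mem_image, Finset.mem_univ, true_and]
      exact ⟨fun ⟨i, hi⟩ => ⟨σ i, hi⟩, fun ⟨i, hi⟩ => ⟨σ.symm i, by simpa using hi⟩⟩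
    · intro σ _ τ _ h
      ext i
      exact congrArg Fin.val (hs.injective (congrFun h i))
    · intro r hr
      rw [Finset.mem_filter] at hr
      have hr2 : ∀ i, ∃ j, s j = r i := fun i => by
        have : r i ∈ Finset.univ.image s := by
          rw [hsS, ← hr.2]
          exact Finset.mem_image_of_mem _ (Finset.mem_univ i)
        simpa using this
      choose σ hσ using hr2
      have hrinj : Function.Injective r := by
        rw [← Set.injOn_univ, ← Finset.coe_univ]
        refine Finset.injOn_of_card_image_eq ?_
        rw [hr.2, hS, Finset.card_univ, Fintype.card_fin]
      have hσinj : Function.Injective σ := fun i j hij => hrinj (by rw [← hσ i, ← hσ j, hij])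
      refine ⟨Equiv.ofBijective σ (Finite.injective_iff_bijective.1 hσinj), Finset.mem_univ _, ?_⟩
      ext i
      simp [hσ]
    · intro σ _
      rfl
  have h2 : ∀ σ : Equiv.Perm (Fin n), (Matrix.vandermonde fun i => (s (σ i) : ℚ)).det =
      Equiv.Perm.sign σ * diffProd S := fun σ => by
    conv_rhs => rw [← hsS, diffProd_image_of_strictMono hs, ← Matrix.det_permute]
    rfl
  have h3 : ∀ σ : Equiv.Perm (Fin n), ∏ i, w (s (σ i)) = ∏ x ∈ S, w x := fun σ => by
    conv_rhs => rw [← hsS, Finset.prod_image hs.injective.injOn]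
    exact Equiv.prod_comp σ fun i => w (s i)
  -- The signs of the reordered Vandermonde determinants assemble the monomials into a second factor
  -- `diffProd S`, by the Leibniz formula.
  have h4 : diffProd S = ∑ σ : Equiv.Perm (Fin n),
      (Equiv.Perm.sign σ : ℚ) * ∏ i, (s (σ i) : ℚ) ^ (i : ℕ) := by
    conv_lhs => rw [← hsS, diffProd_image_of_strictMono hs, Matrix.det_apply']
    rfl
  rw [h1, sq, mul_assoc]
  nth_rewrite 1 [h4]
  rw [Finset.sum_mul]
  refine Finset.sum_congr rfl fun σ _ => ?_
  rw [h2, Finset.prod_mul_distrib, h3]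
  ring

/-- The Cauchy–Binet formula for Hankel determinants of moments. -/
theorem sum_powersetCard_diffProd_sq (n : ℕ) (X : Finset ℤ) (w : ℤ → ℚ) :
    ∑ S ∈ X.powersetCard n, diffProd S ^ 2 * ∏ x ∈ S, w x =
      (Matrix.of fun i j : Fin n => ∑ x ∈ X, w x * (x : ℚ) ^ ((i : ℕ) + j)).det := by
  have h1 := (Matrix.detRowAlternating (n := Fin n) (R := ℚ)).toMultilinearMap.map_sum_finset
    (fun i (x : ℤ) (j : Fin n) => w x * (x : ℚ) ^ (i : ℕ) * (x : ℚ) ^ (j : ℕ)) (fun _ => X)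
  have h2 : (Matrix.of fun i j : Fin n => ∑ x ∈ X, w x * (x : ℚ) ^ ((i : ℕ) + j)) =
      fun i : Fin n => ∑ x ∈ X, fun j : Fin n =>
        w x * (x : ℚ) ^ (i : ℕ) * (x : ℚ) ^ (j : ℕ) := by
    ext i j
    rw [Finset.sum_apply]
    exact Finset.sum_congr rfl fun x _ => by rw [pow_add, mul_assoc]
  have h3 : ∀ r : Fin n → ℤ, (Matrix.detRowAlternating (n := Fin n) (R := ℚ)).toMultilinearMap
      (fun i j => w (r i) * (r i : ℚ) ^ (i : ℕ) * (r i : ℚ) ^ (j : ℕ)) =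
      (∏ i, w (r i) * (r i : ℚ) ^ (i : ℕ)) * (Matrix.vandermonde fun i => (r i : ℚ)).det :=
    fun r => by
      rw [← Matrix.det_mul_column]
      rfl
  simp only [h3] at h1
  rw [h2]
  refine Eq.trans ?_ h1.symm
  have h4 : ∑ r ∈ Fintype.piFinset (fun _ : Fin n => X) with
        Finset.univ.image r ∈ X.powersetCard n,
        (∏ i, w (r i) * (r i : ℚ) ^ (i : ℕ)) * (Matrix.vandermonde fun i => (r i : ℚ)).det =
      ∑ r ∈ Fintype.piFinset (fun _ : Fin n => X),
        (∏ i, w (r i) * (r i : ℚ) ^ (i : ℕ)) * (Matrix.vandermonde fun i => (r i : ℚ)).det := by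
    refine Finset.sum_filter_of_ne fun r hr hne => ?_
    have hinj : Function.Injective fun i => (r i : ℚ) :=
      Matrix.det_vandermonde_ne_zero_iff.1 (right_ne_zero_of_mul hne)
    have hinj' : Function.Injective r := fun i j h => hinj (by simp [h])
    rw [Finset.mem_powersetCard, Finset.card_image_of_injective _ hinj', Finset.card_univ,
      Fintype.card_fin]
    refine ⟨fun x hx => ?_, rfl⟩
    obtain ⟨i, -, rfl⟩ := Finset.mem_image.1 hx
    exact Fintype.mem_piFinset.1 hr i
  rw [← h4, ← Finset.sum_fiberwise_of_maps_to (t := X.powersetCard n)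
    (g := fun r : Fin n → ℤ => Finset.univ.image r) fun r hr => (Finset.mem_filter.1 hr).2]
  refine Finset.sum_congr rfl fun S hS => ?_
  have hS' := Finset.mem_powersetCard.1 hS
  rw [← sum_orderings_vandermonde hS'.2 X hS'.1 w, Finset.filter_filter]
  refine Finset.sum_congr (Finset.filter_congr fun r _ => ?_) fun _ _ => rfl
  constructor
  · rintro rfl
    exact ⟨hS, rfl⟩
  · exact fun h => h.2

theorem prod_erase_sub_eq (X : Finset ℤ) (x : ℤ) :
    ∏ y ∈ X.erase x, ((x : ℚ) - y) =
      (-1) ^ (X.filter (x < ·)).card * ∏ y ∈ X.erase x, |(y : ℚ) - x| := by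
  have h : (X.erase x).filter (x < ·) = X.filter (x < ·) := by
    ext y
    simp only [Finset.mem_filter, Finset.mem_erase]
    exact ⟨fun h => ⟨h.1.2, h.2⟩, fun h => ⟨⟨h.2.ne', h.1⟩, h.2⟩⟩
  rw [← h, ← Finset.prod_const, Finset.prod_filter, ← Finset.prod_mul_distrib]
  refine Finset.prod_congr rfl fun y hy => ?_
  split_ifs with hxy
  · have : (x : ℚ) < y := by exact_mod_cast hxy
    rw [abs_of_pos (by linarith)]
    ring
  · have : (y : ℚ) ≤ x := by exact_mod_cast not_lt.1 hxy
    rw [abs_of_nonpos (by linarith)]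
    ring

/-- The sum is the divided difference of x^r over `X`, the coefficient of degree |X| - 1 in the
Lagrange interpolant of x^r, which is x^r itself. -/
theorem sum_pow_div_prod_erase_sub {X : Finset ℤ} {r : ℕ} (hr : r + 1 < X.card) :
    ∑ x ∈ X, (x : ℚ) ^ r / ∏ y ∈ X.erase x, ((x : ℚ) - y) = 0 := by
  have h := Lagrange.coeff_eq_sum (s := X) (v := fun x : ℤ => (x : ℚ))
    (fun _ _ _ _ h => Int.cast_injective (α := ℚ) h) (P := Polynomial.X ^ r)
    (by rw [Polynomial.degree_X_pow]; exact_mod_cast (by omega : r < X.card))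
  rw [Polynomial.coeff_X_pow, if_neg (by omega)] at h
  simpa using h.symm

/-- Splitting a set of `2n+1` integers into two parts in all ways, the products of differences add
up to a power of two times the product for the alternating splitting. -/
theorem sum_diffProd_mul_diffProd_sdiff {n : ℕ} {X Y : Finset ℤ} (hX : X.card = 2 * n + 1)
    (hYX : Y ⊆ X) (hY : Y.card = n) (hodd : ∀ x ∈ X, x ∈ Y ↔ Odd (X.filter (x < ·)).card) :
    ∑ S ∈ X.powersetCard n, diffProd S * diffProd (X \ S) =
      2 ^ n * (diffProd Y * diffProd (X \ Y)) := by
  set W : ℤ → ℚ := fun x => (∏ y ∈ X.erase x, |(y : ℚ) - x|)⁻¹ with hW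
  -- In the vanishing sum the sign at `x` is minus one exactly on `Y`. So `Y` and its complement
  -- have equal moments, and the moment on `X` is twice that on `Y`.
  have hmoment : ∀ r, r < 2 * n →
      ∑ x ∈ X, W x * (x : ℚ) ^ r = ∑ x ∈ Y, 2 * W x * (x : ℚ) ^ r := by
    intro r hr
    have h0 := sum_pow_div_prod_erase_sub (X := X) (r := r) (by omega)
    have h1 : ∀ x ∈ X, (x : ℚ) ^ r / ∏ y ∈ X.erase x, ((x : ℚ) - y) =
        W x * (x : ℚ) ^ r - if x ∈ Y then 2 * W x * (x : ℚ) ^ r else 0 := by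
      intro x hx
      rw [prod_erase_sub_eq, div_eq_mul_inv, mul_inv]
      split_ifs with h
      · rw [((hodd x hx).1 h).neg_one_pow]
        simp only [hW]
        norm_num
        ring
      · rw [(Nat.not_odd_iff_even.1 (mt (hodd x hx).2 h)).neg_one_pow]
        simp only [hW]
        norm_num
        ring
    rw [Finset.sum_congr rfl h1, Finset.sum_sub_distrib, Finset.sum_ite_mem,
      Finset.inter_eq_right.2 hYX] at h0
    linarith
  have hsplit : ∀ S ∈ X.powersetCard n, diffProd S * diffProd (X \ S) =
      diffProd X * (diffProd S ^ 2 * ∏ x ∈ S, W x) := fun S hS => by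
    rw [diffProd_sdiff (Finset.mem_powersetCard.1 hS).1]
    ring
  have hdet : (Matrix.of fun i j : Fin n => ∑ x ∈ X, W x * (x : ℚ) ^ ((i : ℕ) + j)) =
      Matrix.of fun i j : Fin n => ∑ x ∈ Y, 2 * W x * (x : ℚ) ^ ((i : ℕ) + j) := by
    ext i j
    exact hmoment _ (by omega)
  -- The Hankel entries involve only exponents i + j ≤ 2n - 2. As `Y` has exactly `n` points,
  -- Cauchy–Binet read backwards on `Y` has a single term.
  rw [Finset.sum_congr rfl hsplit, ← Finset.mul_sum, sum_powersetCard_diffProd_sq, hdet,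
    ← sum_powersetCard_diffProd_sq, ← hY, Finset.powersetCard_self, Finset.sum_singleton,
    Finset.prod_mul_distrib, Finset.prod_const, diffProd_sdiff hYX]
  ring

/-! ### The two alternating classes and their products of differences -/

/-- The positive even and negative odd integers of absolute value at most `2q`. -/
noncomputable def evenClass (q : ℕ) : Finset ℤ :=
  (Finset.Icc (-(2 * q : ℤ)) (2 * q)).filter fun x => (x % 2 = 0 ∧ 0 < x) ∨ (x % 2 = 1 ∧ x < 0)

/-- The positive odd and negative even integers of absolute value at most `2q + 1`. -/
noncomputable def oddClass (q : ℕ) : Finset ℤ :=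
  (Finset.Icc (-(2 * q + 1 : ℤ)) (2 * q + 1)).filter fun x =>
    (x % 2 = 1 ∧ 0 < x) ∨ (x % 2 = 0 ∧ x < 0)

theorem mem_evenClass {q : ℕ} {x : ℤ} : x ∈ evenClass q ↔ (-(2 * q : ℤ) ≤ x ∧ x ≤ 2 * q) ∧
    ((x % 2 = 0 ∧ 0 < x) ∨ (x % 2 = 1 ∧ x < 0)) := by
  rw [evenClass, Finset.mem_filter, Finset.mem_Icc]

theorem mem_oddClass {q : ℕ} {x : ℤ} : x ∈ oddClass q ↔
    (-(2 * q + 1 : ℤ) ≤ x ∧ x ≤ 2 * q + 1) ∧ ((x % 2 = 1 ∧ 0 < x) ∨ (x % 2 = 0 ∧ x < 0)) := by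
  rw [oddClass, Finset.mem_filter, Finset.mem_Icc]

theorem evenClass_zero : evenClass 0 = ∅ := by
  ext x
  simp only [mem_evenClass, Finset.notMem_empty, iff_false]
  omega

theorem oddClass_zero : oddClass 0 = {1} := by
  ext x
  simp only [mem_oddClass, Finset.mem_singleton]
  omega

theorem evenClass_succ (q : ℕ) :
    evenClass (q + 1) = insert (-(2 * q + 1 : ℤ)) (insert (2 * q + 2 : ℤ) (evenClass q)) := by
  ext x
  simp only [mem_evenClass, Finset.mem_insert]
  omega

theorem oddClass_succ (q : ℕ) :
    oddClass (q + 1) = insert (-(2 * q + 2 : ℤ)) (insert (2 * q + 3 : ℤ) (oddClass q)) := by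
  ext x
  simp only [mem_oddClass, Finset.mem_insert]
  omega

theorem notMem_evenClass (q : ℕ) : (2 * q + 2 : ℤ) ∉ evenClass q ∧
    -(2 * q + 1 : ℤ) ∉ insert (2 * q + 2 : ℤ) (evenClass q) := by
  simp only [mem_evenClass, Finset.mem_insert]
  omega

theorem notMem_oddClass (q : ℕ) : (2 * q + 3 : ℤ) ∉ oddClass q ∧
    -(2 * q + 2 : ℤ) ∉ insert (2 * q + 3 : ℤ) (oddClass q) := by
  simp only [mem_oddClass, Finset.mem_insert]
  omega

theorem card_evenClass (q : ℕ) : (evenClass q).card = 2 * q := by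
  induction q with
  | zero => rw [evenClass_zero]; rfl
  | succ q ih =>
    rw [evenClass_succ, Finset.card_insert_of_notMem (notMem_evenClass q).2,
      Finset.card_insert_of_notMem (notMem_evenClass q).1, ih]
    ring

theorem card_oddClass (q : ℕ) : (oddClass q).card = 2 * q + 1 := by
  induction q with
  | zero => rw [oddClass_zero]; rfl
  | succ q ih =>
    rw [oddClass_succ, Finset.card_insert_of_notMem (notMem_oddClass q).2,
      Finset.card_insert_of_notMem (notMem_oddClass q).1, ih]
    ring

theorem prod_evenClass (q : ℕ) (f : ℤ → ℚ) : ∏ x ∈ evenClass q, f x =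
    (∏ i ∈ Finset.range q, f (2 * i + 2)) * ∏ i ∈ Finset.range q, f (-(2 * i + 1)) := by
  induction q with
  | zero => simp [evenClass_zero]
  | succ q ih =>
    rw [evenClass_succ, Finset.prod_insert (notMem_evenClass q).2,
      Finset.prod_insert (notMem_evenClass q).1, ih, Finset.prod_range_succ,
      Finset.prod_range_succ]
    ring

theorem prod_oddClass (q : ℕ) (f : ℤ → ℚ) : ∏ x ∈ oddClass q, f x =
    (∏ i ∈ Finset.range (q + 1), f (2 * i + 1)) * ∏ i ∈ Finset.range q, f (-(2 * i + 2)) := by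
  induction q with
  | zero => simp [oddClass_zero]
  | succ q ih =>
    rw [oddClass_succ, Finset.prod_insert (notMem_oddClass q).2,
      Finset.prod_insert (notMem_oddClass q).1, ih, Finset.prod_range_succ _ (q + 1),
      Finset.prod_range_succ _ q, Finset.prod_range_succ _ q]
    push_cast
    ring_nf

theorem prod_range_reflect_two_mul (q : ℕ) :
    ∏ i ∈ Finset.range q, (2 * q - 2 * i : ℚ) = ∏ i ∈ Finset.range q, (2 * i + 2 : ℚ) := by
  rw [← Finset.prod_range_reflect]
  refine Finset.prod_congr rfl fun i hi => ?_
  have := Finset.mem_range.1 hi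
  rw [Nat.sub_sub, Nat.cast_sub (by omega)]
  push_cast
  ring

/-- The new points 2q + 2 and -(2q + 1) see the old class at the same distances with the roles of
the two signs exchanged, whence the square; 4q + 3 is their mutual distance. -/
theorem diffProd_evenClass_succ (q : ℕ) : diffProd (evenClass (q + 1)) = diffProd (evenClass q) *
    ((∏ i ∈ Finset.range q, (2 * i + 2 : ℚ)) * ∏ i ∈ Finset.range q, (2 * q + 3 + 2 * i : ℚ)) ^ 2 *
      (4 * q + 3) := by
  have e1 : ∏ i ∈ Finset.range q, |((2 * i + 2 : ℤ) : ℚ) - (2 * q + 2 : ℤ)| =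
      ∏ i ∈ Finset.range q, (2 * q - 2 * i : ℚ) := by
    refine Finset.prod_congr rfl fun i hi => ?_
    have : (i : ℚ) < q := by exact_mod_cast Finset.mem_range.1 hi
    push_cast
    rw [abs_of_neg (by linarith)]
    ring
  have e2 : ∏ i ∈ Finset.range q, |((-(2 * i + 1) : ℤ) : ℚ) - (2 * q + 2 : ℤ)| =
      ∏ i ∈ Finset.range q, (2 * q + 3 + 2 * i : ℚ) := by
    refine Finset.prod_congr rfl fun i hi => ?_
    push_cast
    rw [abs_of_neg (by linarith [(i.cast_nonneg : (0 : ℚ) ≤ i), (q.cast_nonneg : (0 : ℚ) ≤ q)])]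
    ring
  have e3 : ∏ i ∈ Finset.range q, |((2 * i + 2 : ℤ) : ℚ) - (-(2 * q + 1) : ℤ)| =
      ∏ i ∈ Finset.range q, (2 * q + 3 + 2 * i : ℚ) := by
    refine Finset.prod_congr rfl fun i hi => ?_
    push_cast
    rw [abs_of_pos (by linarith [(i.cast_nonneg : (0 : ℚ) ≤ i), (q.cast_nonneg : (0 : ℚ) ≤ q)])]
    ring
  have e4 : ∏ i ∈ Finset.range q, |((-(2 * i + 1) : ℤ) : ℚ) - (-(2 * q + 1) : ℤ)| =
      ∏ i ∈ Finset.range q, (2 * q - 2 * i : ℚ) := by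
    refine Finset.prod_congr rfl fun i hi => ?_
    have : (i : ℚ) < q := by exact_mod_cast Finset.mem_range.1 hi
    push_cast
    rw [abs_of_pos (by linarith)]
    ring
  have e5 : |((2 * q + 2 : ℤ) : ℚ) - (-(2 * q + 1) : ℤ)| = 4 * q + 3 := by
    push_cast
    rw [abs_of_pos (by linarith [(q.cast_nonneg : (0 : ℚ) ≤ q)])]
    ring
  rw [evenClass_succ, diffProd_insert (notMem_evenClass q).2,
    diffProd_insert (notMem_evenClass q).1, Finset.prod_insert (notMem_evenClass q).1,
    prod_evenClass, prod_evenClass, e1, e2, e3, e4, e5, prod_range_reflect_two_mul]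
  ring

/-- The positive points outnumber the negative ones by one, so beyond the square there remain the
factors 2q + 2 and 2q + 3, besides the mutual distance 4q + 5 of the new points. -/
theorem diffProd_oddClass_succ (q : ℕ) : diffProd (oddClass (q + 1)) = diffProd (oddClass q) *
    ((∏ i ∈ Finset.range q, (2 * i + 2 : ℚ)) * ∏ i ∈ Finset.range q, (2 * q + 5 + 2 * i : ℚ)) ^ 2 *
      ((2 * q + 2) * (2 * q + 3) * (4 * q + 5)) := by
  have hq : (0 : ℚ) ≤ q := q.cast_nonneg
  have e1 : ∏ i ∈ Finset.range (q + 1), |((2 * i + 1 : ℤ) : ℚ) - (2 * q + 3 : ℤ)| =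
      (∏ i ∈ Finset.range q, (2 * i + 2 : ℚ)) * (2 * q + 2) := by
    rw [← Finset.prod_range_succ (fun i : ℕ => (2 * i + 2 : ℚ)), ← prod_range_reflect_two_mul]
    refine Finset.prod_congr rfl fun i hi => ?_
    have : (i : ℚ) ≤ q := by exact_mod_cast Finset.mem_range_succ_iff.1 hi
    push_cast
    rw [abs_of_neg (by linarith)]
    ring
  have e2 : ∏ i ∈ Finset.range q, |((-(2 * i + 2) : ℤ) : ℚ) - (2 * q + 3 : ℤ)| =
      ∏ i ∈ Finset.range q, (2 * q + 5 + 2 * i : ℚ) := by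
    refine Finset.prod_congr rfl fun i hi => ?_
    push_cast
    rw [abs_of_neg (by linarith [(i.cast_nonneg : (0 : ℚ) ≤ i)])]
    ring
  have e3 : ∏ i ∈ Finset.range (q + 1), |((2 * i + 1 : ℤ) : ℚ) - (-(2 * q + 2) : ℤ)| =
      (∏ i ∈ Finset.range q, (2 * q + 5 + 2 * i : ℚ)) * (2 * q + 3) := by
    rw [Finset.prod_range_succ']
    congr 1
    · refine Finset.prod_congr rfl fun i hi => ?_
      push_cast
      rw [abs_of_pos (by linarith [(i.cast_nonneg : (0 : ℚ) ≤ i)])]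
      ring
    · push_cast
      rw [abs_of_pos (by linarith)]
      ring
  have e4 : ∏ i ∈ Finset.range q, |((-(2 * i + 2) : ℤ) : ℚ) - (-(2 * q + 2) : ℤ)| =
      ∏ i ∈ Finset.range q, (2 * i + 2 : ℚ) := by
    rw [← prod_range_reflect_two_mul]
    refine Finset.prod_congr rfl fun i hi => ?_
    have : (i : ℚ) < q := by exact_mod_cast Finset.mem_range.1 hi
    push_cast
    rw [abs_of_pos (by linarith)]
    ring
  have e5 : |((2 * q + 3 : ℤ) : ℚ) - (-(2 * q + 2) : ℤ)| = 4 * q + 5 := by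
    push_cast
    rw [abs_of_pos (by linarith)]
    ring
  rw [oddClass_succ, diffProd_insert (notMem_oddClass q).2,
    diffProd_insert (notMem_oddClass q).1, Finset.prod_insert (notMem_oddClass q).1,
    prod_oddClass, prod_oddClass, e1, e2, e3, e4, e5]
  ring

/-- The product of differences for the two classes together, both of index `q`. -/
def oddFormula (q : ℕ) : ℚ :=
  (∏ i ∈ Finset.range q, (2 * i + 2 : ℚ) ^ (4 * (q - (i + 1)) + 1)) *
    (∏ i ∈ Finset.range q, (2 * i + 3 : ℚ) ^ (2 * i + 2)) *
      ∏ i ∈ Finset.range q, (2 * q + 3 + 2 * i : ℚ) ^ (2 * q - 1 - 2 * i)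

/-- The product of differences for the even class of index `q + 1` and the odd class of index `q`. -/
def evenFormula (q : ℕ) : ℚ :=
  (∏ i ∈ Finset.range q, (2 * i + 2 : ℚ) ^ (4 * (q - i) - 1)) *
    (∏ i ∈ Finset.range q, (2 * i + 3 : ℚ) ^ (2 * i + 2)) *
      ∏ i ∈ Finset.range (q + 1), (2 * q + 3 + 2 * i : ℚ) ^ (2 * q + 1 - 2 * i)

theorem evenFormula_eq (q : ℕ) : evenFormula q = oddFormula q *
    ((∏ i ∈ Finset.range q, (2 * i + 2 : ℚ)) * ∏ i ∈ Finset.range q, (2 * q + 3 + 2 * i : ℚ)) ^ 2 *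
      (4 * q + 3) := by
  have e1 : ∏ i ∈ Finset.range q, (2 * i + 2 : ℚ) ^ (4 * (q - i) - 1) =
      (∏ i ∈ Finset.range q, (2 * i + 2 : ℚ) ^ (4 * (q - (i + 1)) + 1)) *
        (∏ i ∈ Finset.range q, (2 * i + 2 : ℚ)) ^ 2 := by
    rw [← Finset.prod_pow, ← Finset.prod_mul_distrib]
    refine Finset.prod_congr rfl fun i hi => ?_
    have := Finset.mem_range.1 hi
    rw [← pow_add]
    congr 1
    omega
  have e2 : ∏ i ∈ Finset.range (q + 1), (2 * q + 3 + 2 * i : ℚ) ^ (2 * q + 1 - 2 * i) =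
      (∏ i ∈ Finset.range q, (2 * q + 3 + 2 * i : ℚ) ^ (2 * q - 1 - 2 * i)) *
        (∏ i ∈ Finset.range q, (2 * q + 3 + 2 * i : ℚ)) ^ 2 * (4 * q + 3) := by
    rw [Finset.prod_range_succ, ← Finset.prod_pow, ← Finset.prod_mul_distrib]
    congr 1
    · refine Finset.prod_congr rfl fun i hi => ?_
      have := Finset.mem_range.1 hi
      rw [← pow_add]
      congr 1
      omega
    · rw [show 2 * q + 1 - 2 * q = 1 by omega]
      ring
  rw [evenFormula, oddFormula, e1, e2]
  ring

theorem oddFormula_succ (q : ℕ) : oddFormula (q + 1) = evenFormula q *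
    ((∏ i ∈ Finset.range q, (2 * i + 2 : ℚ)) * ∏ i ∈ Finset.range q, (2 * q + 5 + 2 * i : ℚ)) ^ 2 *
      ((2 * q + 2) * (2 * q + 3) * (4 * q + 5)) := by
  have e1 : ∏ i ∈ Finset.range (q + 1), (2 * i + 2 : ℚ) ^ (4 * (q + 1 - (i + 1)) + 1) =
      (∏ i ∈ Finset.range q, (2 * i + 2 : ℚ) ^ (4 * (q - i) - 1)) *
        (∏ i ∈ Finset.range q, (2 * i + 2 : ℚ)) ^ 2 * (2 * q + 2) := by
    rw [Finset.prod_range_succ, ← Finset.prod_pow, ← Finset.prod_mul_distrib]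
    congr 1
    · refine Finset.prod_congr rfl fun i hi => ?_
      have := Finset.mem_range.1 hi
      rw [← pow_add]
      congr 1
      omega
    · simp
  have e2 : ∏ i ∈ Finset.range (q + 1),
        (2 * ((q + 1 : ℕ) : ℚ) + 3 + 2 * i) ^ (2 * (q + 1) - 1 - 2 * i) =
      (∏ i ∈ Finset.range q, (2 * q + 5 + 2 * i : ℚ) ^ (2 * q - 1 - 2 * i)) *
        (∏ i ∈ Finset.range q, (2 * q + 5 + 2 * i : ℚ)) ^ 2 * (4 * q + 5) := by
    rw [Finset.prod_range_succ, ← Finset.prod_pow, ← Finset.prod_mul_distrib]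
    congr 1
    · refine Finset.prod_congr rfl fun i hi => ?_
      have := Finset.mem_range.1 hi
      rw [← pow_add, show 2 * (q + 1) - 1 - 2 * i = 2 * q - 1 - 2 * i + 2 by omega]
      congr 1
      push_cast
      ring
    · rw [show 2 * (q + 1) - 1 - 2 * q = 1 by omega]
      push_cast
      ring
  -- The split-off power of 2q + 3, times the extra factor 2q + 3, becomes the last term of the
  -- second product of `oddFormula`.
  have e3 : ∏ i ∈ Finset.range (q + 1), (2 * q + 3 + 2 * i : ℚ) ^ (2 * q + 1 - 2 * i) =
      (∏ i ∈ Finset.range q, (2 * q + 5 + 2 * i : ℚ) ^ (2 * q - 1 - 2 * i)) *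
        (2 * q + 3) ^ (2 * q + 1) := by
    rw [Finset.prod_range_succ']
    congr 1
    · refine Finset.prod_congr rfl fun i _ => ?_
      rw [show 2 * q + 1 - 2 * (i + 1) = 2 * q - 1 - 2 * i by omega]
      congr 1
      push_cast
      ring
    · simp
  rw [evenFormula, oddFormula, e1, e2, e3, Finset.prod_range_succ _ q]
  ring

theorem diffProd_classes_odd (q : ℕ) :
    diffProd (evenClass q) * diffProd (oddClass q) = oddFormula q := by
  induction q with
  | zero =>
    have : diffProd {1} = 1 := by
      rw [← insert_empty_eq, diffProd_insert (Finset.notMem_empty _)]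
      simp
    simp [evenClass_zero, oddClass_zero, oddFormula, this]
  | succ q ih =>
    rw [diffProd_evenClass_succ, diffProd_oddClass_succ, oddFormula_succ, evenFormula_eq, ← ih]
    ring

theorem diffProd_classes_even (q : ℕ) :
    diffProd (evenClass (q + 1)) * diffProd (oddClass q) = evenFormula q := by
  rw [diffProd_evenClass_succ, evenFormula_eq, ← diffProd_classes_odd]
  ring

theorem V_pred_succ (n : ℕ) : V n = V (n - 1) * n.factorial := by
  rcases n with _ | n
  · simp [V]
  · simp [V, Finset.prod_Icc_succ_top]

/-- At `n = 0` the truncated index gives `V 0 = 1`, in agreement with the convention V_{-1} = 1. -/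
theorem dentedConst_eq (n : ℕ) : dentedConst n = 2 ^ (n * (n + 1) / 2) / (V (n - 1) : ℚ) := by
  induction n with
  | zero => simp [dentedConst, V]
  | succ n ih =>
    have h : (n + 1) * (n + 1 + 1) / 2 = n * (n + 1) / 2 + (n + 1) := by
      rw [show (n + 1) * (n + 1 + 1) = n * (n + 1) + (n + 1) * 2 by ring,
        Nat.add_mul_div_right _ _ two_pos]
    rw [dentedConst, ih, h, Nat.add_sub_cancel, V_pred_succ n,
      pow_add _ (n * (n + 1) / 2)]
    push_cast
    field_simp

/-! ### Coordinates and symmetries of the region -/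

/-- Passage from the coordinates of `RowAdj` to lower left corners. -/
def rowEquiv : ℤ × ℤ ≃ ℤ × ℤ where
  toFun p := (p.1 - p.2, p.2)
  invFun p := (p.1 + p.2, p.2)
  left_inv p := by simp
  right_inv p := by simp

theorem adjoins_rowEquiv (a b : ℤ × ℤ) : Adjoins (rowEquiv a) (rowEquiv b) ↔ RowAdj a b := by
  simp only [Adjoins, RowAdj, rowEquiv, Equiv.coe_fn_mk, abs_eq (zero_le_one (α := ℤ))]
  omega

/-- The number of domino tilings, in the coordinates of `RowAdj`. -/
noncomputable def rowCount (R : Finset (ℤ × ℤ)) : ℚ :=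
  (numDominoTilings ((R.map rowEquiv.toEmbedding : Finset (ℤ × ℤ)) : Set (ℤ × ℤ)) : ℚ)

theorem isMatchingCount_rowCount : IsMatchingCount RowAdj rowCount := by
  have h := isMatchingCount_numDominoTilings.comp rowEquiv
  simp only [adjoins_rowEquiv] at h
  exact h

theorem unitSquare_subset_tiltedRectangle {a b : ℕ} {c : ℤ × ℤ} :
    unitSquare c ⊆ tiltedRectangle a b ↔ c.1 + c.2 + 2 ≤ (b : ℤ) + 1 ∧
      (b : ℤ) - 2 * a - 1 ≤ c.1 + c.2 ∧ c.2 + 1 - c.1 ≤ (b : ℤ) + 1 ∧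
        -((b : ℤ) + 1) ≤ c.2 - (c.1 + 1) := by
  constructor
  · intro h
    have h1 : ((c.1 : ℝ) + 1, (c.2 : ℝ) + 1) ∈ tiltedRectangle a b :=
      h ⟨by simp, by simp, by simp, by simp⟩
    have h2 : ((c.1 : ℝ), (c.2 : ℝ)) ∈ tiltedRectangle a b :=
      h ⟨by simp, by simp, by simp, by simp⟩
    have h3 : ((c.1 : ℝ), (c.2 : ℝ) + 1) ∈ tiltedRectangle a b :=
      h ⟨by simp, by simp, by simp, by simp⟩
    have h4 : ((c.1 : ℝ) + 1, (c.2 : ℝ)) ∈ tiltedRectangle a b :=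
      h ⟨by simp, by simp, by simp, by simp⟩
    have e1 := h1.1
    have e2 := h2.2.1
    have e3 := h3.2.2.1
    have e4 := h4.2.2.2
    simp only at e1 e2 e3 e4
    refine ⟨?_, by exact_mod_cast e2, by exact_mod_cast e3, by exact_mod_cast e4⟩
    have : (c.1 : ℝ) + c.2 + 2 ≤ b + 1 := by linarith
    exact_mod_cast this
  · rintro ⟨h1, h2, h3, h4⟩ p ⟨p1, p2, p3, p4⟩
    have h1 : (c.1 : ℝ) + c.2 + 2 ≤ b + 1 := by exact_mod_cast h1
    have h2 : (b : ℝ) - 2 * a - 1 ≤ c.1 + c.2 := by exact_mod_cast h2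
    have h3 : (c.2 : ℝ) + 1 - c.1 ≤ b + 1 := by exact_mod_cast h3
    have h4 : -((b : ℝ) + 1) ≤ c.2 - (c.1 + 1) := by exact_mod_cast h4
    exact ⟨by linarith, by linarith, by linarith, by linarith⟩

theorem map_rowRegion {k : ℕ} (hk : 1 ≤ k) :
    (((rowRegion k).map rowEquiv.toEmbedding : Finset (ℤ × ℤ)) : Set (ℤ × ℤ)) =
      undentedAztecRectangle (2 * k - 1) (2 * k) := by
  ext ⟨x, y⟩
  rw [Finset.mem_coe, Finset.mem_map_equiv, undentedAztecRectangle, Set.mem_ofPred_eq,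
    unitSquare_subset_tiltedRectangle]
  simp only [rowEquiv, Equiv.coe_fn_symm_mk, mem_rowRegion]
  push_cast [show 1 ≤ 2 * k by omega]
  omega

theorem numDominoTilings_eq_rowCount {k : ℕ} (hk : 1 ≤ k) (p : ℤ × ℤ) :
    (numDominoTilings (undentedAztecRectangle (2 * k - 1) (2 * k) \ {rowEquiv p}) : ℚ) =
      rowCount ((rowRegion k).erase p) := by
  rw [rowCount, Finset.map_erase, Finset.coe_erase, map_rowRegion hk]
  rfl

/-- The reflection that reverses the order of the rows. -/
def flipRows : ℤ × ℤ ≃ ℤ × ℤ where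
  toFun p := (-p.1, p.2 - p.1)
  invFun p := (-p.1, p.2 - p.1)
  left_inv p := by simp
  right_inv p := by simp

/-- The reflection that reverses each row. -/
def flipColumns : ℤ × ℤ ≃ ℤ × ℤ where
  toFun p := (p.1, p.1 - p.2)
  invFun p := (p.1, p.1 - p.2)
  left_inv p := by simp
  right_inv p := by simp

theorem rowAdj_flipRows (a b : ℤ × ℤ) : RowAdj (flipRows a) (flipRows b) ↔ RowAdj a b := by
  simp only [RowAdj, flipRows, Equiv.coe_fn_mk]
  omega

theorem rowAdj_flipColumns (a b : ℤ × ℤ) :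
    RowAdj (flipColumns a) (flipColumns b) ↔ RowAdj a b := by
  simp only [RowAdj, flipColumns, Equiv.coe_fn_mk]
  omega

theorem rowRegion_map_flipRows (k : ℕ) :
    (rowRegion k).map flipRows.toEmbedding = rowRegion k := by
  ext ⟨u, y⟩
  simp only [Finset.mem_map_equiv, flipRows, Equiv.coe_fn_symm_mk, mem_rowRegion]
  omega

theorem rowRegion_map_flipColumns (k : ℕ) :
    (rowRegion k).map flipColumns.toEmbedding = rowRegion k := by
  ext ⟨u, y⟩
  simp only [Finset.mem_map_equiv, flipColumns, Equiv.coe_fn_symm_mk, mem_rowRegion]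
  omega

theorem rowCount_erase_flipRows (k : ℕ) (p : ℤ × ℤ) :
    rowCount ((rowRegion k).erase (flipRows p)) = rowCount ((rowRegion k).erase p) := by
  rw [← isMatchingCount_rowCount.map_eq flipRows rowAdj_flipRows ((rowRegion k).erase p),
    Finset.map_erase, rowRegion_map_flipRows]
  rfl

theorem rowCount_erase_flipColumns (k : ℕ) (p : ℤ × ℤ) :
    rowCount ((rowRegion k).erase (flipColumns p)) = rowCount ((rowRegion k).erase p) := by
  rw [← isMatchingCount_rowCount.map_eq flipColumns rowAdj_flipColumns ((rowRegion k).erase p),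
    Finset.map_erase, rowRegion_map_flipColumns]
  rfl

/-- All four neighbors of the center give the same number of tilings. -/
theorem rowCount_erase_of_rowAdj (k : ℕ) {p : ℤ × ℤ} (hp : RowAdj (0, 0) p) :
    rowCount ((rowRegion k).erase p) = rowCount ((rowRegion k).erase (1, 0)) := by
  obtain ⟨u, y⟩ := p
  have h : (u, y) = (1, 0) ∨ (u, y) = flipColumns (1, 0) ∨ (u, y) = flipRows (1, 0) ∨
      (u, y) = flipRows (flipColumns (1, 0)) := by
    simp only [RowAdj, flipRows, flipColumns, Equiv.coe_fn_mk, Prod.mk.injEq] at hp ⊢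
    omega
  rcases h with h | h | h | h <;> rw [h]
  · rw [rowCount_erase_flipColumns]
  · rw [rowCount_erase_flipRows]
  · rw [rowCount_erase_flipRows, rowCount_erase_flipColumns]

/-! ### Cutting along the row above the center -/

/-- The positions in the row above the center, except for the removed one. -/
noncomputable def middleRow (k : ℕ) : Finset ℤ := (Finset.Icc (1 - (k : ℤ)) k).erase 0

theorem mem_middleRow {k : ℕ} {x : ℤ} : x ∈ middleRow k ↔ x ≠ 0 ∧ 1 - (k : ℤ) ≤ x ∧ x ≤ k := by
  rw [middleRow, Finset.mem_erase, Finset.mem_Icc]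

theorem card_middleRow {k : ℕ} (hk : 1 ≤ k) : (middleRow k).card = 2 * k - 1 := by
  rw [middleRow, Finset.card_erase_of_mem (by rw [Finset.mem_Icc]; omega), Int.card_Icc]
  omega

theorem rowCount_upper {k : ℕ} (hk : 1 ≤ k) {S : Finset ℤ} (hS : S ⊆ middleRow k) :
    rowCount (rowsAbove k 1 ∪ {1} ×ˢ S) =
      if S.card = k - 1 then dentedConst (k - 1) * diffProd S else 0 := by
  rw [Finset.union_comm]
  refine count_dented isMatchingCount_rowCount k (k - 1) 1 (by omega) (by omega) S fun x hx => ?_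
  have := mem_middleRow.1 (hS hx)
  rw [Finset.mem_Icc]
  omega

/-- Reversing the rows sends row 1 to row -1 and moves its positions by -1. The part below then
becomes the dented rectangle above row -1, which is `count_dented` with `m = 0` and `n = k`. -/
theorem rowCount_lower {k : ℕ} {S : Finset ℤ} (hS : S ⊆ middleRow k) :
    rowCount ((rowRegion k).filter (fun p => p.1 < 1) ∪ {1} ×ˢ S) =
      if S.card = k then dentedConst k * diffProd S else 0 := by
  have hmap : ((rowRegion k).filter (fun p => p.1 < 1) ∪ {1} ×ˢ S).map flipRows.toEmbedding =
      {2 * 0 - 1} ×ˢ S.image (· + -1) ∪ rowsAbove k (2 * 0 - 1) := by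
    ext ⟨u, y⟩
    simp only [Finset.mem_map_equiv, flipRows, Equiv.coe_fn_symm_mk, Finset.mem_union,
      Finset.mem_filter, mem_rowRegion, Finset.mem_product, Finset.mem_singleton, mem_rowsAbove,
      Finset.mem_image]
    constructor
    · rintro (h | ⟨h1, h2⟩)
      · right
        omega
      · exact Or.inl ⟨by omega, y - u, h2, by omega⟩
    · rintro (⟨h1, x, h2, h3⟩ | h)
      · right
        refine ⟨by omega, ?_⟩
        rwa [show y - u = x by omega]
      · left
        omega
  rw [← isMatchingCount_rowCount.map_eq flipRows rowAdj_flipRows, hmap,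
    count_dented isMatchingCount_rowCount k k 0 (by omega) le_rfl, diffProd_image_add,
    Finset.card_image_of_injective _ (add_left_injective (-1 : ℤ))]
  intro y hy
  obtain ⟨x, hx, rfl⟩ := Finset.mem_image.1 hy
  have := mem_middleRow.1 (hS hx)
  rw [Finset.mem_Icc]
  omega

/-- The tilings of the holey region as a sum over the dents along the row above the center. -/
theorem rowCount_erase_eq_sum {k : ℕ} (hk : 1 ≤ k) :
    rowCount ((rowRegion k).erase (1, 0)) = dentedConst (k - 1) * dentedConst k *
      ∑ S ∈ (middleRow k).powersetCard (k - 1), diffProd S * diffProd (middleRow k \ S) := by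
  have hregion : (rowRegion k).erase (1, 0) =
      {1} ×ˢ middleRow k ∪ (rowsAbove k 1 ∪ (rowRegion k).filter fun p => p.1 < 1) := by
    ext ⟨u, y⟩
    simp only [Finset.mem_erase, Finset.mem_union, Finset.mem_product, Finset.mem_singleton,
      mem_rowsAbove, Finset.mem_filter, mem_rowRegion, mem_middleRow, ne_eq, Prod.mk.injEq]
    omega
  have hsum : ∀ f : Finset (ℤ × ℤ) → ℚ, ∑ S ∈ ({1} ×ˢ middleRow k : Finset (ℤ × ℤ)).powerset, f S =
      ∑ S ∈ (middleRow k).powerset, f ({1} ×ˢ S) := by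
    intro f
    symm
    refine Finset.sum_bij (fun S _ => {1} ×ˢ S) (fun S hS => ?_) (fun S _ T _ h => ?_)
      (fun S hS => ?_) (fun _ _ => rfl)
    · exact Finset.mem_powerset.2 (Finset.product_subset_product_right (Finset.mem_powerset.1 hS))
    · ext x
      have := Finset.ext_iff.1 h (1, x)
      simpa using this
    · have hS := Finset.mem_powerset.1 hS
      refine ⟨S.image Prod.snd, Finset.mem_powerset.2 fun x hx => ?_, ?_⟩
      · obtain ⟨p, hp, rfl⟩ := Finset.mem_image.1 hx
        exact (Finset.mem_product.1 (hS hp)).2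
      · ext ⟨u, x⟩
        simp only [Finset.mem_product, Finset.mem_singleton, Finset.mem_image, Prod.exists,
          exists_eq_right]
        constructor
        · rintro ⟨rfl, v, hv⟩
          have := Finset.mem_singleton.1 (Finset.mem_product.1 (hS hv)).1
          simp only at this
          rwa [this] at hv
        · intro h
          exact ⟨Finset.mem_singleton.1 (Finset.mem_product.1 (hS h)).1, u, h⟩
  rw [hregion, isMatchingCount_rowCount.cut RowAdj.irrefl, hsum, Finset.powersetCard_eq_filter,
    Finset.sum_filter, Finset.mul_sum]
  · refine Finset.sum_congr rfl fun S hS => ?_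
    have hS := Finset.mem_powerset.1 hS
    have hc := Finset.card_sdiff_of_subset hS
    have hle := Finset.card_le_card hS
    rw [card_middleRow hk] at hc hle
    have hdiff : ({1} ×ˢ middleRow k \ {1} ×ˢ S : Finset (ℤ × ℤ)) = {1} ×ˢ (middleRow k \ S) := by
      ext ⟨u, x⟩
      simp only [Finset.mem_sdiff, Finset.mem_product]
      tauto
    rw [hdiff, rowCount_upper hk hS, rowCount_lower Finset.sdiff_subset]
    split_ifs with h1 h2 h2
    · ring
    · omega
    · ring
    · ring
  · refine Finset.disjoint_left.2 ?_
    rintro ⟨u, y⟩ h h'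
    simp only [mem_rowsAbove, Finset.mem_filter] at h h'
    omega
  · refine Finset.disjoint_left.2 ?_
    rintro ⟨u, y⟩ h h'
    simp only [mem_rowsAbove, Finset.mem_product, Finset.mem_singleton] at h h'
    omega
  · refine Finset.disjoint_left.2 ?_
    rintro ⟨u, y⟩ h h'
    simp only [Finset.mem_filter, Finset.mem_product, Finset.mem_singleton] at h h'
    omega
  · rintro ⟨u, y⟩ h ⟨u', y'⟩ h'
    simp only [mem_rowsAbove, Finset.mem_filter, RowAdj] at h h' ⊢
    omega
  · rintro ⟨u, y⟩ h ⟨u', y'⟩ h'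
    simp only [Finset.mem_product, Finset.mem_singleton, RowAdj] at h h' ⊢
    omega

/-- The hole at 0 lowers the count by one for negative `x`; hence the alternating subset has
opposite parities on the two sides of 0. -/
theorem card_filter_lt_middleRow {k : ℕ} {x : ℤ} (hx : x ∈ middleRow k) :
    (((middleRow k).filter (x < ·)).card : ℤ) = if 0 < x then k - x else k - x - 1 := by
  have hx := mem_middleRow.1 hx
  split_ifs with h
  · have : (middleRow k).filter (x < ·) = Finset.Ioc x k := by
      ext y
      simp only [Finset.mem_filter, mem_middleRow, Finset.mem_Ioc]
      omega
    rw [this, Int.card_Ioc]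
    omega
  · have : (middleRow k).filter (x < ·) = (Finset.Ioc x k).erase 0 := by
      ext y
      simp only [Finset.mem_filter, mem_middleRow, Finset.mem_Ioc, Finset.mem_erase]
      omega
    rw [this, Finset.card_erase_of_mem (by rw [Finset.mem_Ioc]; omega), Int.card_Ioc]
    omega

theorem rowCount_erase_eq_of_alternating {k : ℕ} (hk : 1 ≤ k) {Y Z : Finset ℤ}
    (hY : Y.card = k - 1) (hYZ : middleRow k \ Y = Z) (hsub : Y ⊆ middleRow k)
    (hodd : ∀ x ∈ middleRow k, x ∈ Y ↔ ((0 < x ∧ (k - x) % 2 = 1) ∨ (x < 0 ∧ (k - x) % 2 = 0))) :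
    rowCount ((rowRegion k).erase (1, 0)) =
      2 ^ (k ^ 2 + k - 1) / ((V (k - 2) : ℚ) * V (k - 1)) * (diffProd Y * diffProd Z) := by
  have hsum := sum_diffProd_mul_diffProd_sdiff (n := k - 1) (X := middleRow k)
    (by rw [card_middleRow hk]; omega) hsub hY fun x hx => by
      have h0 := (mem_middleRow.1 hx).1
      have h1 := card_filter_lt_middleRow hx
      rw [hodd x hx, Nat.odd_iff]
      split_ifs at h1 <;> omega
  rw [rowCount_erase_eq_sum hk, hsum, hYZ, dentedConst_eq, dentedConst_eq]
  obtain ⟨n, rfl⟩ : ∃ n, k = n + 1 := ⟨k - 1, by omega⟩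
  -- The two dented constants and the splitting sum contribute the three exponents of 2.
  have hexp : (n + 1) ^ 2 + (n + 1) - 1 = n * (n + 1) / 2 + (n + 1) * (n + 1 + 1) / 2 + n := by
    have h1 : (n + 1) * (n + 1 + 1) / 2 = n * (n + 1) / 2 + (n + 1) := by
      rw [show (n + 1) * (n + 1 + 1) = n * (n + 1) + (n + 1) * 2 by ring,
        Nat.add_mul_div_right _ _ two_pos]
    have h2 : n * (n + 1) / 2 * 2 = n * (n + 1) := Nat.div_mul_cancel (Nat.even_mul_succ_self n).two_dvd
    have h3 : (n + 1) ^ 2 = n * (n + 1) + n + 1 := by ring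
    omega
  rw [hexp, pow_add, pow_add, Nat.add_sub_cancel, show n + 1 - 2 = n - 1 by omega]
  ring

theorem rowCount_erase_odd (q : ℕ) :
    rowCount ((rowRegion (2 * q + 1)).erase (1, 0)) =
      2 ^ ((2 * q + 1) ^ 2 + (2 * q + 1) - 1) / ((V (2 * q - 1) : ℚ) * V (2 * q)) *
        oddFormula q := by
  rw [rowCount_erase_eq_of_alternating (by omega) (Y := evenClass q) (Z := oddClass q),
    diffProd_classes_odd]
  · rw [show 2 * q + 1 - 2 = 2 * q - 1 by omega, Nat.add_sub_cancel]
  · rw [card_evenClass, Nat.add_sub_cancel]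
  · ext x
    simp only [Finset.mem_sdiff, mem_middleRow, mem_evenClass, mem_oddClass]
    push_cast
    omega
  · intro x
    simp only [mem_middleRow, mem_evenClass]
    push_cast
    omega
  · intro x
    simp only [mem_middleRow, mem_evenClass]
    push_cast
    omega

theorem rowCount_erase_even (q : ℕ) :
    rowCount ((rowRegion (2 * q + 2)).erase (1, 0)) =
      2 ^ ((2 * q + 2) ^ 2 + (2 * q + 2) - 1) / ((V (2 * q) : ℚ) * V (2 * q + 1)) *
        evenFormula q := by
  rw [rowCount_erase_eq_of_alternating (by omega) (Y := oddClass q) (Z := evenClass (q + 1)),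
    mul_comm (diffProd (oddClass q)), diffProd_classes_even]
  · rfl
  · rw [card_oddClass]
    rfl
  · ext x
    simp only [Finset.mem_sdiff, mem_middleRow, mem_evenClass, mem_oddClass]
    push_cast
    omega
  · intro x
    simp only [mem_middleRow, mem_oddClass]
    push_cast
    omega
  · intro x
    simp only [mem_middleRow, mem_oddClass]
    push_cast
    omega

/-! ### The theorem -/

theorem prod_Icc_one_eq_prod_range (n : ℕ) (f : ℕ → ℚ) :
    ∏ d ∈ Finset.Icc 1 n, f d = ∏ i ∈ Finset.range n, f (i + 1) := by
  rw [Finset.range_eq_Ico, Finset.prod_Ico_add' f 0 n 1]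
  rfl

theorem mainTheorem3 (k : ℕ) (hk : 1 ≤ k) (c e : ℤ × ℤ)
    (hc : IsCentralSquare (2 * k - 1) (2 * k) c) (he : Adjoins c e) :
    (∀ q : ℕ, k = 2 * q →
      (numDominoTilings (undentedAztecRectangle (2 * k - 1) (2 * k) \ {e}) : ℚ) =
        2 ^ ((2 * q) ^ 2 + 2 * q - 1) / ((V (2 * q - 2) : ℚ) * V (2 * q - 1)) *
          (∏ d ∈ Finset.Icc 1 (q - 1), (2 * d : ℚ) ^ (4 * (q - d) - 1)) *
          (∏ d ∈ Finset.Icc 1 (q - 1), (2 * d + 1 : ℚ) ^ (2 * d)) *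
          ∏ d ∈ Finset.Icc 0 (q - 1), (2 * q + 1 + 2 * d : ℚ) ^ (2 * q - 1 - 2 * d)) ∧
    (∀ q : ℕ, k = 2 * q + 1 →
      (numDominoTilings (undentedAztecRectangle (2 * k - 1) (2 * k) \ {e}) : ℚ) =
        2 ^ ((2 * q + 1) ^ 2 + (2 * q + 1) - 1) / ((V (2 * q - 1) : ℚ) * V (2 * q)) *
          (∏ d ∈ Finset.Icc 1 q, (2 * d : ℚ) ^ (4 * (q - d) + 1)) *
          (∏ d ∈ Finset.Icc 1 q, (2 * d + 1 : ℚ) ^ (2 * d)) *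
          ∏ d ∈ Finset.Icc 1 q, (2 * q + 1 + 2 * d : ℚ) ^ (2 * q + 1 - 2 * d)) := by
  have hc0 : c = rowEquiv (0, 0) := by
    obtain ⟨x, y⟩ := c
    obtain ⟨h1, h2⟩ := hc
    push_cast [show 1 ≤ 2 * k by omega] at h1 h2
    have hx : (x : ℝ) = 0 := by linarith
    have hy : (y : ℝ) = 0 := by linarith
    ext
    · exact_mod_cast hx
    · exact_mod_cast hy
  have hcount : (numDominoTilings (undentedAztecRectangle (2 * k - 1) (2 * k) \ {e}) : ℚ) =
      rowCount ((rowRegion k).erase (1, 0)) := by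
    obtain ⟨p, rfl⟩ := rowEquiv.surjective e
    rw [hc0, adjoins_rowEquiv] at he
    rw [numDominoTilings_eq_rowCount hk, rowCount_erase_of_rowAdj k he]
  rw [hcount]
  constructor
  · rintro q rfl
    -- `hk` excludes `q = 0`, where the truncated subtractions in the formula would matter.
    obtain ⟨q, rfl⟩ : ∃ r, q = r + 1 := ⟨q - 1, by omega⟩
    rw [show 2 * (q + 1) = 2 * q + 2 by ring, rowCount_erase_even, evenFormula, Nat.add_sub_cancel,
      Nat.add_sub_cancel, show 2 * q + 2 - 1 = 2 * q + 1 by omega, prod_Icc_one_eq_prod_range,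
      prod_Icc_one_eq_prod_range, ← Nat.range_succ_eq_Icc_zero, ← mul_assoc, ← mul_assoc]
    congr 1
    · congr 1
      · congr 1
        refine Finset.prod_congr rfl fun i _ => ?_
        rw [show 4 * (q + 1 - (i + 1)) - 1 = 4 * (q - i) - 1 by omega]
        push_cast
        ring
      · refine Finset.prod_congr rfl fun i _ => ?_
        rw [show 2 * (i + 1) = 2 * i + 2 by ring]
        push_cast
        ring
    · refine Finset.prod_congr rfl fun i _ => ?_
      push_cast
      ring
  · rintro q rfl
    rw [rowCount_erase_odd, oddFormula, prod_Icc_one_eq_prod_range,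
      prod_Icc_one_eq_prod_range, prod_Icc_one_eq_prod_range, ← mul_assoc, ← mul_assoc]
    congr 1
    · congr 1
      · congr 1
        refine Finset.prod_congr rfl fun i _ => ?_
        push_cast
        ring
      · refine Finset.prod_congr rfl fun i _ => ?_
        rw [show 2 * (i + 1) = 2 * i + 2 by ring]
        push_cast
        ring
    · refine Finset.prod_congr rfl fun i _ => ?_
      rw [show 2 * q + 1 - 2 * (i + 1) = 2 * q - 1 - 2 * i by omega]
      push_cast
      ring
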